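/- Let $n\ge 0$ be an integer and let $F:\mathbb{R}^{n+1}\to\mathbb{R}$ be a Minkowski norm: $F$ is convex, positively $1$-homogeneous ($F(tx)=tF(x)$ for $t\ge 0$), $F(x)>0$ for $x\neq 0$, $F\in C^\infty(\mathbb{R}^{n+1}\setminus\{0\})$, and $\mathrm{Hess}(\tfrac12F^2)$ is positive definite on $\mathbb{R}^{n+1}\setminus\{0\}$. Let $\mathcal{W}=\{x : F(x)=1\}$ be its Wulff shape, and for $x\ne0$ put $$G(x)(\xi,\eta)=D^2(\tfrac12F^2)(x)(\xi,\eta),\qquad Q(x)(\xi,\eta,\zeta)=D^3(\tfrac12F^2)(x)(\xi,\eta,\zeta).$$ Let $g=G|_{T\mathcal{W}}$, a Riemannian metric on $\mathcal{W}$, and let $d\mu=F^0(\bar\nu)\,d\mathcal{H}^n$ be the anisotropic measure on $\mathcal{W}$, where $\bar\nu$ is the Euclidean unit outer normal, $\mathcal{H}^n$ the $n$-dimensional Hausdorff measure, and $F^0(\xi)=\sup_{x\neq0}\langle x,\xi\rangle/F(x)$. For $S\in C^2(\mathcal{W})$ and a $g$-orthonormal basis $e_1,\dots,e_n$ of $T_z\mathcal{W}$,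 let $S_i,S_{ij}$ be the components of the first and second covariant derivatives of $S$ with respect to the Levi-Civita connection of $g$, let $Q_{ijk}=Q(z)(e_i,e_j,e_k)$, and put $u_{ij}=S_{ij}-\tfrac12Q_{ijk}S_k+S\delta_{ij}$ (repeated indices are summed from $1$ to $n$). With $\sigma_n(u_{ij})=\det(u_{ij})$, regarded as a function of the $n^2$ entries, define for $v\in C^2(\mathcal{W})$ $$L_S(v)=\frac{\partial\sigma_n}{\partial u_{ij}}(u_{ij})\,\bigl(v_{ij}-\tfrac12Q_{ijk}v_k+v\,\delta_{ij}\bigr),$$ evaluated at each point $z\in\mathcal{W}$ in the orthonormal frame $e_i=\partial_iX(0)$ of an arbitrary smooth local parametrization $X$ of $\mathcal{W}$ with $X(0)=z$ and $g(\partial_iX(0),\partial_jX(0))=\delta_{ij}$. Then for all $S,v,w\in C^2(\mathcal{W})$ the functions $w\,L_S(v)$ and $v\,L_S(w)$ are $\mu$-integrable on $\mathcal{W}$ and $$\int_{\mathcal{W}} w\,L_S(v)\,d\mu=\int_{\mathcal{W}} v\,L_S(w)\,d\mu .$$ -/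

import Mathlib

open MeasureTheory Topology
open scoped ContDiff

namespace Aniso

/-- Euclidean space of dimension `n + 1`. -/
abbrev E (n : ℕ) : Type := EuclideanSpace ℝ (Fin (n + 1))

/-- A Minkowski norm: convex, positively `1`-homogeneous, positive and smooth away from the
origin, with `Hess (F² / 2)` positive definite away from the origin. The symmetry `F (-x) = F x`
is not required. -/
structure IsMinkowskiNorm {n : ℕ} (F : E n → ℝ) : Prop where
  convex : ConvexOn ℝ Set.univ F
  homogeneous : ∀ t : ℝ, 0 ≤ t → ∀ x : E n, F (t • x) = t * F x
  pos : ∀ x : E n, x ≠ 0 → 0 < F x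
  smooth : ContDiffOn ℝ ∞ F {0}ᶜ
  elliptic : ∀ x : E n, x ≠ 0 → ∀ ξ : E n, ξ ≠ 0 →
    0 < iteratedFDeriv ℝ 2 (fun z => F z ^ 2 / 2) x ![ξ, ξ]

/-- The Wulff shape `{F = 1}`. -/
def wulff {n : ℕ} (F : E n → ℝ) : Set (E n) := {x | F x = 1}

/-- The dual norm `F⁰(ξ) = sup_{x ≠ 0} ⟨x, ξ⟩ / F(x)`. -/
noncomputable def dualNorm {n : ℕ} (F : E n → ℝ) (ξ : E n) : ℝ :=
  ⨆ x : {x : E n // x ≠ 0}, inner ℝ x.1 ξ / F x.1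

/-- The Euclidean unit outer normal of the level set of `F` through `x`. -/
noncomputable def unitNormal {n : ℕ} (F : E n → ℝ) (x : E n) : E n :=
  ‖gradient F x‖⁻¹ • gradient F x

/-- The anisotropic measure `F⁰(ν̄) dℋⁿ` on the Wulff shape, as a measure on the ambient space;
`μHE[n]` is the `n`-dimensional Hausdorff measure. -/
noncomputable def anisoMeasure {n : ℕ} (F : E n → ℝ) : Measure (E n) :=
  (μHE[n].restrict (wulff F)).withDensity
    fun x => ENNReal.ofReal (dualNorm F (unitNormal F x))

/-- The metric `G(x)(ξ, η) = D²(F²/2)(x)(ξ, η)`. -/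
noncomputable def G {n : ℕ} (F : E n → ℝ) (x ξ η : E n) : ℝ :=
  iteratedFDeriv ℝ 2 (fun z => F z ^ 2 / 2) x ![ξ, η]

/-- The tensor `Q(x)(ξ, η, ζ) = D³(F²/2)(x)(ξ, η, ζ)`. -/
noncomputable def Q {n : ℕ} (F : E n → ℝ) (x ξ η ζ : E n) : ℝ :=
  iteratedFDeriv ℝ 3 (fun z => F z ^ 2 / 2) x ![ξ, η, ζ]

/-- The `i`-th partial derivative on a coordinate domain in `ℝⁿ`. -/
noncomputable def pd {n : ℕ} {V : Type*} [NormedAddCommGroup V] [NormedSpace ℝ V]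
    (i : Fin n) (f : (Fin n → ℝ) → V) (y : Fin n → ℝ) : V :=
  fderiv ℝ f y (Pi.single i 1)

/-- The Christoffel symbol `Γᵏᵢⱼ` of a Riemannian metric `g` given in coordinates. -/
noncomputable def christoffel {n : ℕ} (g : (Fin n → ℝ) → Matrix (Fin n) (Fin n) ℝ)
    (k i j : Fin n) (y : Fin n → ℝ) : ℝ :=
  (1 / 2) * ∑ l, (g y)⁻¹ k l *
    (pd i (fun y' => g y' j l) y + pd j (fun y' => g y' i l) y - pd l (fun y' => g y' i j) y)

/-- The second covariant derivative `fᵢⱼ = ∂ᵢ∂ⱼf - Γᵏᵢⱼ ∂ₖf` for the Levi-Civita connection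
of `g`. -/
noncomputable def covHess {n : ℕ} (g : (Fin n → ℝ) → Matrix (Fin n) (Fin n) ℝ)
    (f : (Fin n → ℝ) → ℝ) (i j : Fin n) (y : Fin n → ℝ) : ℝ :=
  pd i (pd j f) y - ∑ k, christoffel g k i j y * pd k f y

/-- The restriction of `G` to the Wulff shape in the local coordinates `X`:
`gᵢⱼ = G(X)(∂ᵢX, ∂ⱼX)`. -/
noncomputable def metric {n : ℕ} (F : E n → ℝ) (X : (Fin n → ℝ) → E n) (y : Fin n → ℝ) :
    Matrix (Fin n) (Fin n) ℝ :=
  Matrix.of fun i j => G F (X y) (pd i X y) (pd j X y)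

/-- `X` is a smooth local parametrization of the Wulff shape near `p = X 0` whose coordinate
vectors at `p` are orthonormal for `g` (in particular linearly independent). -/
structure IsCoordAt {n : ℕ} (F : E n → ℝ) (p : E n) (X : (Fin n → ℝ) → E n) : Prop where
  smooth : ContDiffAt ℝ ∞ X 0
  center : X 0 = p
  mem : ∀ᶠ y in 𝓝 (0 : Fin n → ℝ), X y ∈ wulff F
  orthonormal : metric F X 0 = 1

/-- The matrix `uᵢⱼ = Sᵢⱼ - ½ Qᵢⱼₖ Sₖ + S δᵢⱼ` at the point `X 0`, in the orthonormal frame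
`eᵢ = ∂ᵢX(0)`. -/
noncomputable def uMat {n : ℕ} (F : E n → ℝ) (X : (Fin n → ℝ) → E n) (S : E n → ℝ) :
    Matrix (Fin n) (Fin n) ℝ :=
  Matrix.of fun i j =>
    covHess (metric F X) (S ∘ X) i j 0
      - (1 / 2) * ∑ k, Q F (X 0) (pd i X 0) (pd j X 0) (pd k X 0) * pd k (S ∘ X) 0
      + S (X 0) * (if i = j then 1 else 0)

/-- The partial derivative `∂σₙ/∂uᵢⱼ` of `σₙ = det`, a function of `n²` independent entries. -/
noncomputable def dSigma {n : ℕ} (U : Matrix (Fin n) (Fin n) ℝ) (i j : Fin n) : ℝ :=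
  deriv (fun t : ℝ => (U + Matrix.single i j t).det) 0

/-- The value at `X 0` of `L_S(v) = ∂σₙ/∂uᵢⱼ (uᵢⱼ) (vᵢⱼ - ½ Qᵢⱼₖ vₖ + v δᵢⱼ)`, with
`uᵢⱼ = Sᵢⱼ - ½ Qᵢⱼₖ Sₖ + S δᵢⱼ`. -/
noncomputable def linOp {n : ℕ} (F : E n → ℝ) (X : (Fin n → ℝ) → E n) (S v : E n → ℝ) : ℝ :=
  ∑ i, ∑ j, dSigma (uMat F X S) i j * uMat F X v i j

section

variable {n : ℕ} {F : E n → ℝ}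

theorem ne_zero_of_mem (hF : IsMinkowskiNorm F) {p : E n} (hp : p ∈ wulff F) : p ≠ 0 := by
  rintro rfl
  have h := hF.homogeneous 0 le_rfl 0
  have hp' : F 0 = 1 := hp
  simp [hp'] at h

theorem contDiffAt_F (hF : IsMinkowskiNorm F) {x : E n} (hx : x ≠ 0) : ContDiffAt ℝ ∞ F x :=
  (hF.smooth x hx).contDiffAt (isOpen_compl_singleton.mem_nhds hx)

theorem fderiv_self (hF : IsMinkowskiNorm F) {p : E n} (hp : p ≠ 0) : fderiv ℝ F p p = F p := by
  have h1 : HasDerivAt (fun t : ℝ => F (t • p)) (fderiv ℝ F p p) 1 := by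
    have hd : HasFDerivAt F (fderiv ℝ F p) ((1 : ℝ) • p) := by
      rw [one_smul]
      exact ((contDiffAt_F hF hp).differentiableAt (by simp)).hasFDerivAt
    have := hd.comp_hasDerivAt (1 : ℝ) ((hasDerivAt_id (1 : ℝ)).smul_const p)
    simpa [Function.comp_def] using this
  have h2 : HasDerivAt (fun t : ℝ => t * F p) (F p) 1 := by
    simpa using (hasDerivAt_id (1 : ℝ)).mul_const (F p)
  refine h1.unique (h2.congr_of_eventuallyEq ?_)
  filter_upwards [lt_mem_nhds (zero_lt_one : (0 : ℝ) < 1)] with t ht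
  exact hF.homogeneous t ht.le p

theorem G_eq (x ξ η : E n) :
    G F x ξ η = fderiv ℝ (fderiv ℝ (fun z => F z ^ 2 / 2)) x ξ η := by
  simp [G, iteratedFDeriv_two_apply]

theorem G_symm (hF : IsMinkowskiNorm F) {x : E n} (hx : x ≠ 0) (ξ η : E n) :
    G F x ξ η = G F x η ξ := by
  rw [G_eq, G_eq]
  have h : ContDiffAt ℝ 2 (fun z => F z ^ 2 / 2) x :=
    (((contDiffAt_F hF hx).pow 2).div_const 2).of_le (WithTop.coe_le_coe.2 (le_top : (2 : ℕ∞) ≤ ⊤))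
  exact (h.isSymmSndFDerivAt (by simp)).eq ξ η

theorem exists_orthonormal_of_core {V : Type*} [AddCommGroup V] [Module ℝ V]
    [FiniteDimensional ℝ V] (c : InnerProductSpace.Core ℝ V) (hV : Module.finrank ℝ V = n) :
    ∃ b : Fin n → V, ∀ i j, c.inner (b i) (b j) = if i = j then 1 else 0 := by
  let _ : NormedAddCommGroup V := c.toNormedAddCommGroup
  let _ : InnerProductSpace ℝ V := InnerProductSpace.ofCore c.toCore
  let b := (stdOrthonormalBasis ℝ V).reindex (finCongr hV)
  exact ⟨b, orthonormal_iff_ite.1 b.orthonormal⟩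

/-- Tangent bases orthonormal for `G` exist. -/
theorem exists_frame (hF : IsMinkowskiNorm F) {p : E n} (hp : p ≠ 0) :
    ∃ e : Fin n → E n, (∀ i, fderiv ℝ F p (e i) = 0) ∧
      ∀ i j, G F p (e i) (e j) = if i = j then 1 else 0 := by
  let T := LinearMap.ker (fderiv ℝ F p).toLinearMap
  have hT : Module.finrank ℝ T = n := by
    have h := Module.Dual.finrank_ker_add_one_of_ne_zero (f := (fderiv ℝ F p).toLinearMap) (by
      intro h0
      have h1 := fderiv_self hF hp
      have h2 : fderiv ℝ F p p = 0 := LinearMap.congr_fun h0 p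
      exact (hF.pos p hp).ne (h2.symm.trans h1))
    simpa using h
  let c : InnerProductSpace.Core ℝ T :=
    { inner := fun a b => G F p a b
      conj_inner_symm := fun a b => by simpa using G_symm hF hp b a
      re_inner_nonneg := fun a => by
        by_cases ha : (a : E n) = 0
        · simp [ha, G_eq]
        · exact (hF.elliptic p hp a ha).le
      add_left := fun a b d => by simp [G_eq]
      smul_left := fun a b r => by simp [G_eq]
      definite := fun a ha => by
        by_contra hne
        exact (hF.elliptic p hp a (by simpa using hne)).ne' ha }
  obtain ⟨b, hb⟩ := exists_orthonormal_of_core c hT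
  exact ⟨fun i => (b i : E n), fun i => (b i).2, hb⟩

/-- Orthonormal coordinates exist at every point of the Wulff shape. -/
theorem exists_isCoordAt (hF : IsMinkowskiNorm F) {p : E n} (hp : p ∈ wulff F) :
    ∃ X, IsCoordAt F p X := by
  have hp0 := ne_zero_of_mem hF hp
  have hFp : F p = 1 := hp
  obtain ⟨e, he, ho⟩ := exists_frame hF hp0
  let A : (Fin n → ℝ) →L[ℝ] E n := ∑ i, (ContinuousLinearMap.proj i).smulRight (e i)
  have hA : ∀ i, A (Pi.single i 1) = e i := fun i => by
    simp [A, Pi.single_apply, ite_smul]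
  have hdA : fderiv ℝ F p ∘L A = 0 := by
    ext y
    simp [A, he]
  let Z : (Fin n → ℝ) → E n := fun y => p + A y
  have hZ : HasFDerivAt Z A 0 := by simpa [Z] using A.hasFDerivAt.const_add p
  have hZ0 : Z 0 = p := by simp [Z]
  have hZs : ContDiff ℝ ∞ Z := contDiff_const.add A.contDiff
  have hFZs : ContDiffAt ℝ ∞ (fun y => F (Z y)) 0 :=
    ContDiffAt.comp (0 : Fin n → ℝ) (by rw [hZ0]; exact contDiffAt_F hF hp0) hZs.contDiffAt
  have hFZ0 : F (Z 0) = 1 := by rw [hZ0, hFp]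
  have hFZ : HasFDerivAt (fun y => F (Z y)) (0 : (Fin n → ℝ) →L[ℝ] ℝ) 0 := by
    have hd : HasFDerivAt F (fderiv ℝ F p) (Z 0) := by
      rw [hZ0]; exact ((contDiffAt_F hF hp0).differentiableAt (by simp)).hasFDerivAt
    rw [← hdA]
    exact hd.comp 0 hZ
  let X : (Fin n → ℝ) → E n := fun y => (F (Z y))⁻¹ • Z y
  have hX : HasFDerivAt X A 0 := by
    have h1 := (hasDerivAt_inv (x := F (Z 0)) (by rw [hFZ0]; exact one_ne_zero)).comp_hasFDerivAt
      (0 : Fin n → ℝ) hFZ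
    have h2 := h1.smul hZ
    have h3 : (fun y => (F (Z y))⁻¹) • Z = X := rfl
    simpa [hFZ0, Function.comp_def, h3] using h2
  have hX0 : X 0 = p := by simp [X, hFp, hZ0]
  have hpd : ∀ i, pd i X 0 = e i := fun i => by rw [pd, hX.fderiv, hA]
  refine ⟨X, (hFZs.inv (by rw [hFZ0]; exact one_ne_zero)).smul hZs.contDiffAt, hX0, ?_, ?_⟩
  · have hc : ContinuousAt Z 0 := hZs.continuous.continuousAt
    filter_upwards [hc.eventually_ne (by rw [hZ0]; exact hp0)] with y hy
    have h := hF.pos _ hy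
    change F ((F (Z y))⁻¹ • Z y) = 1
    rw [hF.homogeneous _ (inv_nonneg.2 h.le), inv_mul_cancel₀ h.ne']
  · ext i j
    simp only [metric, Matrix.of_apply, hX0, hpd, ho, Matrix.one_apply]

end

end Aniso

/-! Extend a function on the Wulff shape to a 1-homogeneous `s` on the punctured space and put Y_s =
G⁻¹ ds (`gGrad`). Y_s is 0-homogeneous, so DY_s kills the radial direction; DY_s is self-adjoint for
G because Q is totally symmetric; and in an orthonormal tangent frame its matrix is exactly u_ij
(`IsCoordAt.uMat_eq`). Hence L_S(v) is the derivative of the tangential determinant at DY_s in the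
direction DY_v.

To integrate by parts in flat space instead of on the hypersurface, a radial field ζ = χ(F) x fills
the missing radial slot. `mixedDet`, the coefficient of ab in det(DY_s + a Dζ + b DY_v), equals (χ +
r χ') r⁻ⁿ L_S(v) at the point rz (`mixedDet_gGrad_homExt`). Polarized Jacobian determinants are null
Lagrangians, so ∫ w mixedDet(DY_s, Dζ, DY_v) = -∫ mixedDet(DY_s, Dζ, dw ⊗ Y_v)
(`integral_mul_mixedDet_fderiv`). The operators dw ⊗ Y_v and dv ⊗ Y_w are adjoint for G while DY_s
and Dζ are self-adjoint, so the right side is symmetric in v and w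
(`integral_mul_mixedDet_gGrad_symm`).

In the polar coordinates of F, Lebesgue measure is the cone measure times rⁿ dr, so each side
factors into the integral over the Wulff shape and the same nonzero radial integral
(`integral_mul_mixedDet_eq`, `integral_radial_weight_ne_zero`). The cone measure is μ
(`anisoMeasure_eq_coneMeasure`): near p, a map with derivative the identity at p turns a thin
conical shell into an oblique prism of known volume, with multiplicative errors as close to 1 as
desired. -/

namespace Aniso

/-! ### Jacobian determinants of compactly supported maps integrate to zero. -/

section NullLagrangian

variable {V : Type*} [NormedAddCommGroup V] [NormedSpace ℝ V] [FiniteDimensional ℝ V]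

/-- The determinant of `A` is a linear combination of the numbers `det (1 + tᵢ A) - 1`. -/
theorem exists_det_eq_sum [Nontrivial V] {t₀ : ℝ} (ht₀ : 0 < t₀) :
    ∃ c : ℕ → ℝ, ∀ A : V →L[ℝ] V,
      A.det = ∑ i ∈ Finset.range (Module.finrank ℝ V + 1),
        c i * ((ContinuousLinearMap.id ℝ V + (t₀ / (i + 1)) • A).det - 1) := by
  set N := Module.finrank ℝ V
  have hN : 0 < N := Module.finrank_pos
  let s := Finset.range (N + 1)
  let t : ℕ → ℝ := fun i => t₀ / (i + 1)
  have ht : Set.InjOn t s := by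
    intro i _ j _ hij
    have hi : (i : ℝ) + 1 ≠ 0 := by positivity
    have hj : (j : ℝ) + 1 ≠ 0 := by positivity
    simp only [t] at hij
    rw [div_eq_div_iff hi hj] at hij
    have := mul_left_cancel₀ ht₀.ne' hij
    exact_mod_cast (add_right_cancel this).symm
  -- These are the Lagrange weights extracting the coefficient of t^N from N + 1 nodes; for det(1 +
  -- tA) that coefficient is det A. The constant 1 has none since N > 0, so it may be subtracted.
  refine ⟨fun i => (∏ j ∈ s.erase i, (t i - t j))⁻¹, fun A => ?_⟩
  let b := Module.finBasis ℝ V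
  let M := LinearMap.toMatrix b b A.toLinearMap
  have hM : M.det = A.det := LinearMap.det_toMatrix b _
  let P : Polynomial ℝ :=
    Matrix.det ((Polynomial.X : Polynomial ℝ) • M.map Polynomial.C +
      (1 : Matrix (Fin N) (Fin N) ℝ).map Polynomial.C)
  have hPd : P.natDegree ≤ N := by
    simpa [P] using Polynomial.natDegree_det_X_add_C_le M 1
  have hPc : P.coeff N = M.det := by
    simpa [P] using Polynomial.coeff_det_X_add_C_card M 1
  have hPe : ∀ r : ℝ, P.eval r = (ContinuousLinearMap.id ℝ V + r • A).det := by
    intro r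
    have h1 : (ContinuousLinearMap.id ℝ V + r • A).det
        = (LinearMap.toMatrix b b (LinearMap.id + r • A.toLinearMap)).det :=
      (LinearMap.det_toMatrix b _).symm
    rw [h1, map_add, map_smul, LinearMap.toMatrix_id]
    change Polynomial.evalRingHom r P = _
    rw [RingHom.map_det]
    congr 1
    ext i j
    simp [Matrix.one_apply, add_comm, M]
    split_ifs <;> simp [mul_comm]
  have hdeg : ∀ p : Polynomial ℝ, p.natDegree ≤ N → p.degree < s.card := by
    intro p hp
    simp only [s, Finset.card_range]
    exact lt_of_le_of_lt Polynomial.degree_le_natDegree (by exact_mod_cast Nat.lt_succ_of_le hp)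
  have h1 := Lagrange.coeff_eq_sum ht (hdeg P hPd)
  have h2 := Lagrange.coeff_eq_sum ht (hdeg 1 (by simp))
  simp only [s, Finset.card_range, Nat.add_sub_cancel] at h1 h2
  rw [Polynomial.coeff_one, if_neg hN.ne'] at h2
  rw [← hM, ← hPc, h1, ← sub_zero (Finset.sum _ _), h2, ← Finset.sum_sub_distrib]
  refine Finset.sum_congr rfl fun i _ => ?_
  rw [hPe]
  simp only [Polynomial.eval_one, t]
  ring

variable [MeasurableSpace V] [BorelSpace V]

/-- A perturbation of the identity with Lipschitz constant below 1 is a bijection. It fixes every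
point outside the ball, hence maps the ball onto itself, and the change of variables formula
applies. -/
theorem setIntegral_det_id_add (μ : Measure V) [μ.IsAddHaarMeasure] {f : V → V}
    (hf : ContDiff ℝ 1 f) {K : NNReal} (hK : ∀ x, ‖fderiv ℝ f x‖₊ ≤ K) (hK1 : K < 1)
    (hpos : ∀ x, 0 < (ContinuousLinearMap.id ℝ V + fderiv ℝ f x).det) {R : ℝ}
    (hR : ∀ x, x ∉ Metric.ball (0 : V) R → f x = 0) :
    ∫ x in Metric.ball (0 : V) R, (ContinuousLinearMap.id ℝ V + fderiv ℝ f x).det ∂μ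
      = μ.real (Metric.ball 0 R) := by
  let g : V → V := fun x => x + f x
  have hd : ∀ x, HasFDerivAt f (fderiv ℝ f x) x := fun x =>
    (hf.differentiable (by simp) x).hasFDerivAt
  have hg : ∀ x, HasFDerivAt g (ContinuousLinearMap.id ℝ V + fderiv ℝ f x) x := fun x =>
    (hasFDerivAt_id x).add (hd x)
  have hlip : LipschitzWith K f :=
    lipschitzWith_of_nnnorm_fderiv_le (hf.differentiable (by simp)) hK
  have happ : ApproximatesLinearOn g ((ContinuousLinearEquiv.refl ℝ V : V ≃L[ℝ] V) : V →L[ℝ] V)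
      Set.univ K := by
    rw [ApproximatesLinearOn.approximatesLinearOn_iff_lipschitzOnWith]
    have : g - ⇑((ContinuousLinearEquiv.refl ℝ V : V ≃L[ℝ] V) : V →L[ℝ] V) = f := by
      ext x; simp [g]
    rw [this]
    exact hlip.lipschitzOnWith
  have hc : Subsingleton V ∨
      K < ‖((ContinuousLinearEquiv.refl ℝ V : V ≃L[ℝ] V).symm : V →L[ℝ] V)‖₊⁻¹ := by
    rcases subsingleton_or_nontrivial V with h | h
    · exact Or.inl h
    · right
      have : ‖((ContinuousLinearEquiv.refl ℝ V : V ≃L[ℝ] V).symm : V →L[ℝ] V)‖₊ = 1 := by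
        ext
        simp
      rwa [this, inv_one]
  have hinj : Function.Injective g := Set.injOn_univ.1 (happ.injOn hc)
  have hsurj : Function.Surjective g := happ.surjective hc
  have himg : g '' Metric.ball 0 R = Metric.ball 0 R := by
    have hout : ∀ x, x ∉ Metric.ball (0 : V) R → g x = x := fun x hx => by simp [g, hR x hx]
    ext y
    constructor
    · rintro ⟨x, hx, rfl⟩
      by_contra hy
      have := hinj (hout _ hy)
      rw [this] at hy
      exact hy hx
    · intro hy
      obtain ⟨x, rfl⟩ := hsurj y
      refine ⟨x, ?_, rfl⟩
      by_contra hx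
      rw [hout x hx] at hy
      exact hx hy
  have hcv := lintegral_abs_det_fderiv_eq_addHaar_image μ (s := Metric.ball (0 : V) R)
    Metric.isOpen_ball.measurableSet (fun x _ => (hg x).hasFDerivWithinAt) hinj.injOn
  rw [himg] at hcv
  rw [integral_eq_lintegral_of_nonneg_ae (Filter.Eventually.of_forall fun x => (hpos x).le)]
  · rw [Measure.real, ← hcv]
    congr 1
    refine lintegral_congr fun x => ?_
    rw [abs_of_pos (hpos x)]
  · have : Continuous fun x => (ContinuousLinearMap.id ℝ V + fderiv ℝ f x).det :=
      ContinuousLinearMap.continuous_det.comp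
        (continuous_const.add (hf.continuous_fderiv (by simp)))
    exact this.aestronglyMeasurable

/-- The Jacobian determinant is a null Lagrangian. -/
theorem integral_det_fderiv_eq_zero [Nontrivial V] (μ : Measure V) [μ.IsAddHaarMeasure] {f : V → V}
    (hf : ContDiff ℝ 1 f) (hc : HasCompactSupport f) :
    ∫ x, (fderiv ℝ f x).det ∂μ = 0 := by
  have hcont := hf.continuous_fderiv (by simp)
  obtain ⟨K, hK⟩ := hcont.bounded_above_of_compact_support (hc.fderiv ℝ)
  have hK0 : 0 ≤ K := (norm_nonneg _).trans (hK 0)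
  obtain ⟨R, hR⟩ := hc.isCompact.isBounded.subset_ball (0 : V)
  have hzero : ∀ x, x ∉ Metric.ball (0 : V) R → fderiv ℝ f x = 0 := fun x hx =>
    image_eq_zero_of_notMem_tsupport fun h => hx (hR (tsupport_fderiv_subset ℝ h))
  have hfz : ∀ x, x ∉ Metric.ball (0 : V) R → f x = 0 := fun x hx =>
    image_eq_zero_of_notMem_tsupport fun h => hx (hR h)
  have hev : ∀ᶠ A in 𝓝 (ContinuousLinearMap.id ℝ V), 0 < A.det :=
    ContinuousLinearMap.continuous_det.continuousAt.eventually_const_lt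
      (by simp [ContinuousLinearMap.det])
  obtain ⟨δ, hδ, hball⟩ := Metric.eventually_nhds_iff.1 hev
  -- The bound by δ keeps the determinants positive, the bound by 1 makes id + t f a bijection, for
  -- every 0 < t ≤ t₀.
  obtain ⟨t₀, ht₀, ht1, ht2⟩ : ∃ t₀ : ℝ, 0 < t₀ ∧ t₀ * K < δ ∧ t₀ * K < 1 := by
    refine ⟨min δ 1 / (K + 1), div_pos (lt_min hδ one_pos) (by positivity), ?_, ?_⟩
    · have : min δ 1 / (K + 1) * K < min δ 1 := by
        rw [div_mul_eq_mul_div, div_lt_iff₀ (by positivity)]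
        have : 0 < min δ 1 := lt_min hδ one_pos
        nlinarith
      exact this.trans_le (min_le_left _ _)
    · have : min δ 1 / (K + 1) * K < min δ 1 := by
        rw [div_mul_eq_mul_div, div_lt_iff₀ (by positivity)]
        have : 0 < min δ 1 := lt_min hδ one_pos
        nlinarith
      exact this.trans_le (min_le_right _ _)
  obtain ⟨c, hcA⟩ := exists_det_eq_sum (V := V) ht₀
  have hset : ∫ x, (fderiv ℝ f x).det ∂μ = ∫ x in Metric.ball (0 : V) R, (fderiv ℝ f x).det ∂μ := by
    refine (setIntegral_eq_integral_of_forall_compl_eq_zero fun x hx => ?_).symm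
    rw [hzero x hx, ContinuousLinearMap.det, ContinuousLinearMap.toLinearMap_zero,
      LinearMap.det_zero, zero_pow Module.finrank_pos.ne']
  have hfin : μ (Metric.ball (0 : V) R) < ⊤ := measure_ball_lt_top
  have hint : ∀ t : ℝ, IntegrableOn
      (fun x => (ContinuousLinearMap.id ℝ V + t • fderiv ℝ f x).det) (Metric.ball 0 R) μ := by
    intro t
    have : Continuous fun x => (ContinuousLinearMap.id ℝ V + t • fderiv ℝ f x).det :=
      ContinuousLinearMap.continuous_det.comp (continuous_const.add (hcont.const_smul t))
    exact (this.continuousOn.integrableOn_compact (isCompact_closedBall 0 R)).mono_set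
      Metric.ball_subset_closedBall
  rw [hset]
  rw [show (fun x => (fderiv ℝ f x).det) = _ from funext fun x => hcA _]
  rw [integral_finsetSum]
  · refine Finset.sum_eq_zero fun i _ => ?_
    rw [integral_const_mul, integral_sub (hint _) (integrableOn_const hfin.ne)]
    set t := t₀ / ((i : ℝ) + 1)
    have htpos : 0 < t := by positivity
    have htle : t ≤ t₀ := div_le_self ht₀.le (by linarith [(Nat.cast_nonneg i : (0 : ℝ) ≤ i)])
    have hft : ∀ x, fderiv ℝ (t • f) x = t • fderiv ℝ f x := fun x =>
      fderiv_const_smul (hf.differentiable (by simp) x) t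
    have hnorm : ∀ x, ‖t • fderiv ℝ f x‖ ≤ t₀ * K := fun x => by
      rw [norm_smul, Real.norm_of_nonneg htpos.le]
      exact mul_le_mul htle (hK x) (norm_nonneg _) ht₀.le
    have key := setIntegral_det_id_add μ (f := t • f) (hf.const_smul t)
      (K := ⟨t₀ * K, by positivity⟩) (fun x => by rw [hft]; exact hnorm x)
      (by exact_mod_cast ht2) (fun x => by
        rw [hft]
        exact hball (by
          rw [dist_eq_norm, add_sub_cancel_left]
          exact (hnorm x).trans_lt ht1)) (R := R) (fun x hx => by simp [hfz x hx])
    simp_rw [hft] at key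
    rw [key]
    simp
  · intro i _
    exact ((hint _).sub (integrableOn_const hfin.ne)).const_mul _

end NullLagrangian

/-! ### Polarized determinants: expansion by rows, block form, adjoints. -/

section MixedDet

variable {ι : Type*} [DecidableEq ι]

theorem updateRow_add_smul_updateRow (M A : Matrix ι ι ℝ) (q : ι) (r : ι → ℝ) (s : ℝ) :
    (M + s • A).updateRow q r = M.updateRow q r + s • A.updateRow q 0 := by
  ext i j
  by_cases h : i = q
  · subst h; simp
  · simp [Matrix.updateRow_ne h]

variable [Fintype ι]

/-- Jacobi's formula for the derivative of the determinant along a line, by rows. -/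
theorem hasDerivAt_det_add_smul (M A : Matrix ι ι ℝ) (t : ℝ) :
    HasDerivAt (fun s : ℝ => (M + s • A).det) (∑ q, ((M + t • A).updateRow q (A q)).det) t := by
  let D : ContinuousMultilinearMap ℝ (fun _ : ι => ι → ℝ) ℝ :=
    { (Matrix.detRowAlternating : (ι → ℝ) [⋀^ι]→ₗ[ℝ] ℝ).toMultilinearMap with
      cont := (continuous_id.matrix_det : Continuous fun M : Matrix ι ι ℝ => M.det) }
  let m : ι → ι → ℝ := M
  let a : ι → ι → ℝ := A
  have h1 : HasDerivAt (fun s : ℝ => m + s • a) a t := by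
    simpa using ((hasDerivAt_id t).smul_const a).const_add m
  have h2 := (D.hasFDerivAt (m + t • a)).comp_hasDerivAt t h1
  rw [ContinuousMultilinearMap.linearDeriv_apply] at h2
  exact h2

theorem deriv_det_add_smul (M A : Matrix ι ι ℝ) :
    deriv (fun s : ℝ => (M + s • A).det) 0 = ∑ q, (M.updateRow q (A q)).det := by
  rw [(hasDerivAt_det_add_smul M A 0).deriv]
  simp

theorem hasDerivAt_sum_det_updateRow (M A C : Matrix ι ι ℝ) :
    HasDerivAt (fun s : ℝ => ∑ q, ((M + s • A).updateRow q (C q)).det)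
      (∑ q, ∑ p ∈ Finset.univ.erase q, ((M.updateRow p (A p)).updateRow q (C q)).det) 0 := by
  refine HasDerivAt.fun_sum fun q _ => ?_
  -- The replaced row q does not depend on s, so the direction has zero q-th row and the term p = q
  -- of Jacobi's formula vanishes.
  simp_rw [updateRow_add_smul_updateRow]
  convert! hasDerivAt_det_add_smul (M.updateRow q (C q)) (A.updateRow q 0) 0 using 1
  rw [← Finset.add_sum_erase _ _ (Finset.mem_univ q)]
  rw [show ((M.updateRow q (C q) + (0 : ℝ) • A.updateRow q 0).updateRow q
    ((A.updateRow q 0) q)).det = 0 from Matrix.det_eq_zero_of_row_eq_zero q (by simp), zero_add]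
  refine Finset.sum_congr rfl fun p hp => ?_
  have hpq : p ≠ q := Finset.ne_of_mem_erase hp
  rw [zero_smul, add_zero, Matrix.updateRow_ne hpq]
  congr 1
  exact (Function.update_comm hpq.symm _ _ _).symm

variable {V : Type*} [NormedAddCommGroup V] [NormedSpace ℝ V]

/-- The coefficient of `a b` in `det (B + a Z + b A)`, a polarized determinant. -/
noncomputable def mixedDet (B Z A : V →L[ℝ] V) : ℝ :=
  deriv (fun a : ℝ => deriv (fun b : ℝ => (B + a • Z + b • A).det) 0) 0

theorem det_eq_det_toMatrix (b : Module.Basis ι ℝ V) (A : V →L[ℝ] V) :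
    A.det = (LinearMap.toMatrix b b A.toLinearMap).det :=
  (LinearMap.det_toMatrix b _).symm

theorem mixedDet_zero_mid (B A : V →L[ℝ] V) : mixedDet B 0 A = 0 := by
  simp [mixedDet]

theorem deriv_det_add_smul_clm (b : Module.Basis ι ℝ V) (B A : V →L[ℝ] V) :
    deriv (fun s : ℝ => (B + s • A).det) 0 =
      ∑ q, ((LinearMap.toMatrix b b B.toLinearMap).updateRow q
        (LinearMap.toMatrix b b A.toLinearMap q)).det := by
  rw [← deriv_det_add_smul]
  congr 1
  ext s
  rw [det_eq_det_toMatrix b]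
  simp

theorem mixedDet_eq_sum_toMatrix (b : Module.Basis ι ℝ V) (B Z A : V →L[ℝ] V) :
    mixedDet B Z A = ∑ q, ∑ p ∈ Finset.univ.erase q,
      (((LinearMap.toMatrix b b B.toLinearMap).updateRow p
        (LinearMap.toMatrix b b Z.toLinearMap p)).updateRow q
        (LinearMap.toMatrix b b A.toLinearMap q)).det := by
  rw [← (hasDerivAt_sum_det_updateRow _ _ _).deriv, mixedDet]
  congr 1
  ext a
  rw [deriv_det_add_smul_clm b]
  simp

/-- The mixed determinant of operators of block form. -/
theorem mixedDet_of_block (c : Module.Basis (Unit ⊕ ι) ℝ V) {B Z A : V →L[ℝ] V}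
    {U W : Matrix ι ι ℝ} {α β : ℝ}
    (hB : LinearMap.toMatrix c c B.toLinearMap = Matrix.fromBlocks 0 0 0 U)
    (hA : LinearMap.toMatrix c c A.toLinearMap = Matrix.fromBlocks 0 0 0 W)
    (hZ : LinearMap.toMatrix c c Z.toLinearMap
      = Matrix.fromBlocks (α • 1) 0 0 (β • 1)) :
    mixedDet B Z A = α * deriv (fun b : ℝ => (U + b • W).det) 0 := by
  -- Only Z has a radial entry, so the determinant carries the factor a α; the outer derivative at a
  -- = 0 then leaves no trace of β.
  have hdet : ∀ a b : ℝ, (B + a • Z + b • A).det = a * α * (U + a • β • 1 + b • W).det := by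
    intro a b
    rw [det_eq_det_toMatrix c]
    have : LinearMap.toMatrix c c (B + a • Z + b • A).toLinearMap =
        Matrix.fromBlocks ((a * α) • 1) 0 0 (U + a • β • 1 + b • W) := by
      simp only [ContinuousLinearMap.toLinearMap_add, ContinuousLinearMap.toLinearMap_smul,
        map_add, map_smul, hB, hA, hZ, Matrix.fromBlocks_smul, Matrix.fromBlocks_add]
      simp [smul_smul]
    rw [this, Matrix.det_fromBlocks_zero₂₁]
    simp
  simp_rw [mixedDet, hdet]
  have h1 : ∀ a : ℝ, deriv (fun b : ℝ => a * α * (U + a • β • 1 + b • W).det) 0 =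
      a * (α * ∑ q, ((U + a • β • (1 : Matrix ι ι ℝ)).updateRow q (W q)).det) := by
    intro a
    rw [deriv_const_mul _ (hasDerivAt_det_add_smul _ _ _).differentiableAt, deriv_det_add_smul,
      mul_assoc]
  simp_rw [h1]
  have h2 := (hasDerivAt_id (0 : ℝ)).mul
    ((hasDerivAt_sum_det_updateRow U (β • (1 : Matrix ι ι ℝ)) W).const_mul α)
  rw [deriv_det_add_smul]
  refine h2.deriv.trans ?_
  simp

variable [FiniteDimensional ℝ V]

/-- The rank one projection onto the `p`-th coordinate axis of a basis. -/
noncomputable def axisProj (b : Module.Basis ι ℝ V) (p : ι) : V →L[ℝ] V :=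
  (LinearMap.toContinuousLinearMap (b.coord p)).smulRight (b p)

theorem toMatrix_axisProj_comp (b : Module.Basis ι ℝ V) (p : ι) (A : V →L[ℝ] V) (i j : ι) :
    LinearMap.toMatrix b b (axisProj b p ∘L A).toLinearMap i j =
      if i = p then LinearMap.toMatrix b b A.toLinearMap p j else 0 := by
  simp only [LinearMap.toMatrix_apply, axisProj]
  simp [Finsupp.single_apply, eq_comm]

/-- If B, Z, A are derivatives of maps, the operator on the left is again the derivative of one map.
This is how `mixedDet` becomes a sum of true Jacobian determinants. -/
theorem det_replace (b : Module.Basis ι ℝ V) {p q : ι} (hpq : p ≠ q) (B Z A : V →L[ℝ] V) :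
    (B + axisProj b p ∘L (Z - B) + axisProj b q ∘L (A - B)).det =
      (((LinearMap.toMatrix b b B.toLinearMap).updateRow p
        (LinearMap.toMatrix b b Z.toLinearMap p)).updateRow q
        (LinearMap.toMatrix b b A.toLinearMap q)).det := by
  rw [det_eq_det_toMatrix b]
  congr 1
  ext i j
  rw [ContinuousLinearMap.toLinearMap_add, ContinuousLinearMap.toLinearMap_add, map_add, map_add,
    Matrix.add_apply, Matrix.add_apply, toMatrix_axisProj_comp, toMatrix_axisProj_comp]
  simp only [ContinuousLinearMap.toLinearMap_sub, map_sub, Matrix.sub_apply]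
  by_cases hq : i = q
  · subst hq
    simp [hpq.symm]
  · by_cases hp : i = p
    · subst hp
      simp [hpq]
    · simp [hp, hq]

theorem mixedDet_eq_sum (b : Module.Basis ι ℝ V) (B Z A : V →L[ℝ] V) :
    mixedDet B Z A = ∑ q, ∑ p ∈ Finset.univ.erase q,
      (B + axisProj b p ∘L (Z - B) + axisProj b q ∘L (A - B)).det := by
  rw [mixedDet_eq_sum_toMatrix b]
  refine Finset.sum_congr rfl fun q _ => Finset.sum_congr rfl fun p hp => ?_
  rw [det_replace b (Finset.ne_of_mem_erase hp)]

theorem mixedDet_smul_add (B Z A A' : V →L[ℝ] V) (c : ℝ) :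
    mixedDet B Z (c • A + A') = c * mixedDet B Z A + mixedDet B Z A' := by
  let b := Module.finBasis ℝ V
  simp_rw [mixedDet_eq_sum_toMatrix b, Finset.mul_sum, ← Finset.sum_add_distrib]
  refine Finset.sum_congr rfl fun q _ => Finset.sum_congr rfl fun p _ => ?_
  have : LinearMap.toMatrix b b (c • A + A').toLinearMap q =
      c • LinearMap.toMatrix b b A.toLinearMap q + LinearMap.toMatrix b b A'.toLinearMap q := by
    ext j
    simp [LinearMap.toMatrix_apply]
  rw [this, Matrix.det_updateRow_add, Matrix.det_updateRow_smul]

theorem continuousOn_mixedDet {X : Type*} [TopologicalSpace X] {s : Set X} {B Z A : X → V →L[ℝ] V}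
    (hB : ContinuousOn B s) (hZ : ContinuousOn Z s) (hA : ContinuousOn A s) :
    ContinuousOn (fun x => mixedDet (B x) (Z x) (A x)) s := by
  simp_rw [mixedDet_eq_sum (Module.finBasis ℝ V)]
  refine continuousOn_finsetSum _ fun q _ => continuousOn_finsetSum _ fun p _ => ?_
  refine ContinuousLinearMap.continuous_det.comp_continuousOn ?_
  exact (hB.add (continuousOn_const.clm_comp (hZ.sub hB))).add
    (continuousOn_const.clm_comp (hA.sub hB))

/-- Operators adjoint to each other for a nondegenerate form have the same determinant. -/
theorem det_eq_of_adjoint {g : V →L[ℝ] V →L[ℝ] ℝ} (hg : ∀ ξ, (∀ η, g ξ η = 0) → ξ = 0)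
    {A A' : V →L[ℝ] V} (h : ∀ ξ η, g (A ξ) η = g ξ (A' η)) : A.det = A'.det := by
  let b := Module.finBasis ℝ V
  let g' : V →ₗ[ℝ] V →ₗ[ℝ] ℝ := LinearMap.mk₂ ℝ (fun ξ η => g ξ η) (by simp) (by simp) (by simp)
    (by simp)
  let J := LinearMap.toMatrix₂ b b g'
  have hJ : J.det ≠ 0 := (LinearMap.separatingLeft_iff_det_ne_zero b).1 fun ξ hξ => hg ξ hξ
  have hadj : LinearMap.IsAdjointPair g' g' A.toLinearMap A'.toLinearMap := fun ξ η => h ξ η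
  have hm : Matrix.IsAdjointPair J J (LinearMap.toMatrix b b A.toLinearMap)
      (LinearMap.toMatrix b b A'.toLinearMap) := by
    rw [← isAdjointPair_toLinearMap₂ b b]
    rw [Matrix.toLin_toMatrix, Matrix.toLin_toMatrix, Matrix.toLinearMap₂_toMatrix₂]
    exact hadj
  have := congrArg Matrix.det hm
  rw [Matrix.det_mul, Matrix.det_mul, Matrix.det_transpose, mul_comm] at this
  rw [det_eq_det_toMatrix b, det_eq_det_toMatrix b]
  exact mul_left_cancel₀ hJ this

theorem mixedDet_eq_of_adjoint {g : V →L[ℝ] V →L[ℝ] ℝ} (hg : ∀ ξ, (∀ η, g ξ η = 0) → ξ = 0)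
    {B Z A A' : V →L[ℝ] V} (hB : ∀ ξ η, g (B ξ) η = g ξ (B η))
    (hZ : ∀ ξ η, g (Z ξ) η = g ξ (Z η)) (h : ∀ ξ η, g (A ξ) η = g ξ (A' η)) :
    mixedDet B Z A = mixedDet B Z A' := by
  have : ∀ a b : ℝ, (B + a • Z + b • A).det = (B + a • Z + b • A').det := fun a b =>
    det_eq_of_adjoint hg fun ξ η => by simp [hB, hZ, h]
  simp_rw [mixedDet, this]

end MixedDet

/-! ### Integration by parts for polarized Jacobian determinants. -/

section IntegrationByParts

variable {V : Type*} [NormedAddCommGroup V] [NormedSpace ℝ V]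

theorem fderiv_eq_zero_of_notMem_tsupport {ζ : V → V} {x : V} (hx : x ∉ tsupport ζ) :
    fderiv ℝ ζ x = 0 :=
  image_eq_zero_of_notMem_tsupport fun h => hx (tsupport_fderiv_subset ℝ h)

variable [FiniteDimensional ℝ V]

/-- Multiplication by a cutoff equal to 1 near K. It admits fields singular at the origin:
`mixedDet` vanishes where Dζ does, so only their values near the support of ζ matter. -/
theorem exists_compactSupport_extension {W : Type*} [NormedAddCommGroup W] [NormedSpace ℝ W]
    {K Ω : Set V} (hK : IsCompact K) (hΩ : IsOpen Ω) (hKΩ : K ⊆ Ω) {U : V → W}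
    (hU : ContDiffOn ℝ 1 U Ω) :
    ∃ U' : V → W, ContDiff ℝ 1 U' ∧ HasCompactSupport U' ∧ ∀ x ∈ K, U' =ᶠ[𝓝 x] U := by
  obtain ⟨L, hL, hKL, hLΩ⟩ := exists_compact_between hK hΩ hKΩ
  obtain ⟨f, hf1, hf0, -⟩ := exists_contMDiffMap_one_nhds_of_subset_interior
    (n := 1) (modelWithCornersSelf ℝ V) hK.isClosed hKL
  have hf : ContDiff ℝ 1 f := f.contMDiff.contDiff
  refine ⟨fun x => f x • U x, ?_, ?_, fun x hx => ?_⟩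
  · rw [contDiff_iff_contDiffAt]
    intro x
    by_cases hx : x ∈ Ω
    · exact hf.contDiffAt.smul ((hU x hx).contDiffAt (hΩ.mem_nhds hx))
    · have : (fun x => f x • U x) =ᶠ[𝓝 x] fun _ => 0 := by
        filter_upwards [hL.isClosed.isOpen_compl.mem_nhds fun h => hx (hLΩ h)] with y hy
        rw [hf0 y hy, zero_smul]
      exact contDiffAt_const.congr_of_eventuallyEq this
  · exact HasCompactSupport.intro hL fun x hx => by rw [hf0 x hx, zero_smul]
  · filter_upwards [Filter.Eventually.filter_mono (nhds_le_nhdsSet hx) hf1] with y hy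
    rw [hy, one_smul]

variable [MeasurableSpace V] [BorelSpace V] (μ : Measure V) [μ.IsAddHaarMeasure]

theorem integrable_mixedDet {Ω : Set V} (hΩ : IsOpen Ω) {Y ζ : V → V} {A : V → V →L[ℝ] V}
    (hY : ContDiffOn ℝ 1 Y Ω) (hζ : ContDiff ℝ 1 ζ) (hA : ContinuousOn A Ω)
    (hζc : HasCompactSupport ζ) (hζΩ : tsupport ζ ⊆ Ω) :
    Integrable (fun x => mixedDet (fderiv ℝ Y x) (fderiv ℝ ζ x) (A x)) μ := by
  have h : ContinuousOn (fun x => mixedDet (fderiv ℝ Y x) (fderiv ℝ ζ x) (A x)) Ω :=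
    continuousOn_mixedDet (hY.continuousOn_fderiv_of_isOpen hΩ (by simp))
      (hζ.continuous_fderiv (by simp)).continuousOn hA
  refine (integrableOn_iff_integrable_of_support_subset fun x hx => ?_).1
    ((h.mono hζΩ).integrableOn_compact hζc)
  by_contra hx'
  exact hx (by beta_reduce; rw [fderiv_eq_zero_of_notMem_tsupport hx', mixedDet_zero_mid])

variable [Nontrivial V]

theorem integral_mixedDet_fderiv_of_compactSupport {Y ζ U : V → V} (hY : ContDiff ℝ 1 Y)
    (hζ : ContDiff ℝ 1 ζ) (hU : ContDiff ℝ 1 U) (hYc : HasCompactSupport Y)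
    (hζc : HasCompactSupport ζ) (hUc : HasCompactSupport U) :
    ∫ x, mixedDet (fderiv ℝ Y x) (fderiv ℝ ζ x) (fderiv ℝ U x) ∂μ = 0 := by
  let b := Module.finBasis ℝ V
  let f : Fin (Module.finrank ℝ V) → Fin (Module.finrank ℝ V) → V → V := fun q p x =>
    Y x + axisProj b p (ζ x - Y x) + axisProj b q (U x - Y x)
  have hf : ∀ q p, ContDiff ℝ 1 (f q p) := fun q p =>
    (hY.add ((axisProj b p).contDiff.comp (hζ.sub hY))).add
      ((axisProj b q).contDiff.comp (hU.sub hY))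
  have hfc : ∀ q p, HasCompactSupport (f q p) := fun q p =>
    (hYc.add ((hζc.sub hYc).comp_left (g := axisProj b p) (map_zero _))).add
      ((hUc.sub hYc).comp_left (g := axisProj b q) (map_zero _))
  have hfd : ∀ q p x, fderiv ℝ (f q p) x = fderiv ℝ Y x +
      axisProj b p ∘L (fderiv ℝ ζ x - fderiv ℝ Y x) +
      axisProj b q ∘L (fderiv ℝ U x - fderiv ℝ Y x) := fun q p x => by
    have h1 := (hY.differentiable (by simp) x).hasFDerivAt
    have h2 := (hζ.differentiable (by simp) x).hasFDerivAt
    have h3 := (hU.differentiable (by simp) x).hasFDerivAt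
    exact ((h1.add ((axisProj b p).hasFDerivAt.comp x (h2.sub h1))).add
      ((axisProj b q).hasFDerivAt.comp x (h3.sub h1))).fderiv
  simp_rw [mixedDet_eq_sum b, ← hfd]
  have hi : ∀ q p, Integrable (fun x => (fderiv ℝ (f q p) x).det) μ := fun q p => by
    refine Continuous.integrable_of_hasCompactSupport
      (ContinuousLinearMap.continuous_det.comp ((hf q p).continuous_fderiv (by simp))) ?_
    refine ((hfc q p).fderiv ℝ).comp_left (g := ContinuousLinearMap.det) ?_
    rw [ContinuousLinearMap.det, ContinuousLinearMap.toLinearMap_zero,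
      LinearMap.det_zero, zero_pow Module.finrank_pos.ne']
  rw [integral_finsetSum _ fun q _ => integrable_finsetSum _ fun p _ => hi q p]
  refine Finset.sum_eq_zero fun q _ => ?_
  rw [integral_finsetSum _ fun p _ => hi q p]
  exact Finset.sum_eq_zero fun p _ => integral_det_fderiv_eq_zero μ (hf q p) (hfc q p)

theorem integral_mixedDet_fderiv {Ω : Set V} (hΩ : IsOpen Ω) {Y ζ U : V → V}
    (hY : ContDiffOn ℝ 1 Y Ω) (hζ : ContDiff ℝ 1 ζ) (hU : ContDiffOn ℝ 1 U Ω)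
    (hζc : HasCompactSupport ζ) (hζΩ : tsupport ζ ⊆ Ω) :
    ∫ x, mixedDet (fderiv ℝ Y x) (fderiv ℝ ζ x) (fderiv ℝ U x) ∂μ = 0 := by
  obtain ⟨Y', hY', hYc, hYe⟩ := exists_compactSupport_extension hζc hΩ hζΩ hY
  obtain ⟨U', hU', hUc, hUe⟩ := exists_compactSupport_extension hζc hΩ hζΩ hU
  rw [← integral_mixedDet_fderiv_of_compactSupport μ hY' hζ hU' hYc hζc hUc]
  congr 1
  ext x
  by_cases hx : x ∈ tsupport ζ
  · rw [(hYe x hx).fderiv_eq, (hUe x hx).fderiv_eq]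
  · rw [fderiv_eq_zero_of_notMem_tsupport hx, mixedDet_zero_mid, mixedDet_zero_mid]

/-- Integration by parts for polarized Jacobian determinants. -/
theorem integral_mul_mixedDet_fderiv {Ω : Set V} (hΩ : IsOpen Ω) {Y ζ U : V → V} {φ : V → ℝ}
    (hY : ContDiffOn ℝ 1 Y Ω) (hζ : ContDiff ℝ 1 ζ) (hU : ContDiffOn ℝ 1 U Ω)
    (hφ : ContDiffOn ℝ 1 φ Ω) (hζc : HasCompactSupport ζ) (hζΩ : tsupport ζ ⊆ Ω) :
    ∫ x, φ x * mixedDet (fderiv ℝ Y x) (fderiv ℝ ζ x) (fderiv ℝ U x) ∂μ =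
      -∫ x, mixedDet (fderiv ℝ Y x) (fderiv ℝ ζ x) ((fderiv ℝ φ x).smulRight (U x)) ∂μ := by
  -- Since D(φU) = φ DU + dφ ⊗ U and `mixedDet` is linear in its last slot, this vanishing integral
  -- splits into the two sides of the claim.
  have h0 := integral_mixedDet_fderiv μ hΩ hY hζ (hφ.smul hU) hζc hζΩ
  have hUd := hU.continuousOn_fderiv_of_isOpen hΩ (by simp)
  have hφd := hφ.continuousOn_fderiv_of_isOpen hΩ (by simp)
  have i1 : Integrable
      (fun x => φ x * mixedDet (fderiv ℝ Y x) (fderiv ℝ ζ x) (fderiv ℝ U x)) μ := by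
    refine (integrable_mixedDet μ hΩ hY hζ (hφ.continuousOn.smul hUd) hζc hζΩ).congr
      (Filter.Eventually.of_forall fun x => ?_)
    have := mixedDet_smul_add (fderiv ℝ Y x) (fderiv ℝ ζ x) (fderiv ℝ U x) 0 (φ x)
    simpa [mixedDet] using this
  have i2 : Integrable
      (fun x => mixedDet (fderiv ℝ Y x) (fderiv ℝ ζ x) ((fderiv ℝ φ x).smulRight (U x))) μ := by
    refine integrable_mixedDet μ hΩ hY hζ ?_ hζc hζΩ
    exact (ContinuousLinearMap.smulRightL ℝ V V).continuous₂.comp_continuousOn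
      (hφd.prodMk hU.continuousOn)
  rw [eq_neg_iff_add_eq_zero, ← integral_add i1 i2, ← h0]
  congr 1
  ext x
  by_cases hx : x ∈ tsupport ζ
  · have hxΩ := hΩ.mem_nhds (hζΩ hx)
    have d1 := ((hφ x (hζΩ hx)).contDiffAt hxΩ).differentiableAt (by simp)
    have d2 := ((hU x (hζΩ hx)).contDiffAt hxΩ).differentiableAt (by simp)
    rw [fderiv_smul d1 d2, mixedDet_smul_add]
  · simp_rw [fderiv_eq_zero_of_notMem_tsupport hx, mixedDet_zero_mid]
    simp

end IntegrationByParts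

/-! ### Homogeneous functions and Euler's identity. -/

section Homogeneous

variable {n : ℕ} {W : Type*} [NormedAddCommGroup W] [NormedSpace ℝ W]

/-- Positive homogeneity of degree `k` away from the origin. -/
def IsHomog (k : ℕ) (f : E n → W) : Prop :=
  ∀ t : ℝ, 0 < t → ∀ x : E n, x ≠ 0 → f (t • x) = t ^ k • f x

theorem IsHomog.smul_fderiv {k : ℕ} {f : E n → W} (hf : IsHomog k f) {x : E n} (hx : x ≠ 0)
    (hd : DifferentiableAt ℝ f x) {t : ℝ} (ht : 0 < t) :
    t • fderiv ℝ f (t • x) = t ^ k • fderiv ℝ f x := by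
  rw [← fderiv_comp_smul, ← fderiv_fun_const_smul hd]
  refine Filter.EventuallyEq.fderiv_eq ?_
  filter_upwards [isOpen_compl_singleton.mem_nhds hx] with y hy
  exact hf t ht y hy

theorem IsHomog.fderiv_succ {k : ℕ} {f : E n → W} (hf : IsHomog (k + 1) f)
    (hd : ∀ x : E n, x ≠ 0 → DifferentiableAt ℝ f x) : IsHomog k (fderiv ℝ f) := by
  intro t ht x hx
  have := hf.smul_fderiv hx (hd x hx) ht
  rw [pow_succ', mul_smul] at this
  exact smul_right_injective _ ht.ne' this

/-- Euler's identity. -/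
theorem IsHomog.fderiv_self {k : ℕ} {f : E n → W} (hf : IsHomog k f) {x : E n} (hx : x ≠ 0)
    (hd : DifferentiableAt ℝ f x) : fderiv ℝ f x x = (k : ℝ) • f x := by
  have h1 : HasDerivAt (fun t : ℝ => f (t • x)) (fderiv ℝ f x x) 1 := by
    have hd' : HasFDerivAt f (fderiv ℝ f x) ((1 : ℝ) • x) := by
      rw [one_smul]; exact hd.hasFDerivAt
    have := hd'.comp_hasDerivAt (1 : ℝ) ((hasDerivAt_id (1 : ℝ)).smul_const x)
    simpa [Function.comp_def] using this
  have h2 : HasDerivAt (fun t : ℝ => t ^ k • f x) ((k : ℝ) • f x) 1 := by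
    simpa using (hasDerivAt_pow k (1 : ℝ)).smul_const (f x)
  refine h1.unique (h2.congr_of_eventuallyEq ?_)
  filter_upwards [lt_mem_nhds (zero_lt_one : (0 : ℝ) < 1)] with t ht
  exact hf t ht x hx

end Homogeneous

/-! ### The form G and the total symmetry of Q. -/

section MinkowskiForm

variable {n : ℕ} {F : E n → ℝ}

/-- Half the square of `F`. -/
noncomputable def energy (F : E n → ℝ) (x : E n) : ℝ := F x ^ 2 / 2

/-- The form `G(x)` as a continuous bilinear map. -/
noncomputable def gForm (F : E n → ℝ) (x : E n) : E n →L[ℝ] E n →L[ℝ] ℝ :=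
  fderiv ℝ (fderiv ℝ (energy F)) x

theorem G_eq_gForm (x ξ η : E n) : G F x ξ η = gForm F x ξ η := G_eq x ξ η

theorem Q_eq (x ξ η ζ : E n) : Q F x ξ η ζ = fderiv ℝ (gForm F) x ξ η ζ := by
  rw [Q, iteratedFDeriv_succ_apply_right]
  change iteratedFDeriv ℝ 2 (fderiv ℝ (energy F)) x _ _ = _
  rw [iteratedFDeriv_two_apply]
  rfl

theorem IsMinkowskiNorm.isHomog (hF : IsMinkowskiNorm F) : IsHomog 1 F := fun t ht x _ => by
  rw [hF.homogeneous t ht.le x, pow_one, smul_eq_mul]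

theorem IsMinkowskiNorm.map_zero (hF : IsMinkowskiNorm F) : F 0 = 0 := by
  simpa using hF.homogeneous 0 le_rfl 0

theorem contDiffAt_energy (hF : IsMinkowskiNorm F) {x : E n} (hx : x ≠ 0) :
    ContDiffAt ℝ ∞ (energy F) x :=
  ((contDiffAt_F hF hx).pow 2).div_const 2

theorem isHomog_energy (hF : IsMinkowskiNorm F) : IsHomog 2 (energy F) := fun t ht x _ => by
  rw [energy, energy, hF.homogeneous t ht.le x, smul_eq_mul]
  ring

theorem contDiffAt_fderiv_energy (hF : IsMinkowskiNorm F) {x : E n} (hx : x ≠ 0) :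
    ContDiffAt ℝ ∞ (fderiv ℝ (energy F)) x :=
  (contDiffAt_energy hF hx).fderiv_right (by simp)

theorem contDiffAt_gForm (hF : IsMinkowskiNorm F) {x : E n} (hx : x ≠ 0) :
    ContDiffAt ℝ ∞ (gForm F) x :=
  (contDiffAt_fderiv_energy hF hx).fderiv_right (by simp)

theorem differentiableAt_F (hF : IsMinkowskiNorm F) {x : E n} (hx : x ≠ 0) :
    DifferentiableAt ℝ F x :=
  (contDiffAt_F hF hx).differentiableAt (by simp)

theorem differentiableAt_gForm (hF : IsMinkowskiNorm F) {x : E n} (hx : x ≠ 0) :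
    DifferentiableAt ℝ (gForm F) x :=
  (contDiffAt_gForm hF hx).differentiableAt (by simp)

theorem fderiv_energy (hF : IsMinkowskiNorm F) {x : E n} (hx : x ≠ 0) :
    fderiv ℝ (energy F) x = F x • fderiv ℝ F x := by
  have h := ((differentiableAt_F hF hx).hasFDerivAt.pow 2).mul_const (2 : ℝ)⁻¹
  have he : energy F = fun y => F y ^ 2 * 2⁻¹ := funext fun y => div_eq_mul_inv _ _
  rw [he]
  refine h.fderiv.trans ?_
  ext ξ
  simp
  ring

theorem isHomog_fderiv_energy (hF : IsMinkowskiNorm F) : IsHomog 1 (fderiv ℝ (energy F)) :=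
  (isHomog_energy hF).fderiv_succ fun _ hx => (contDiffAt_energy hF hx).differentiableAt (by simp)

theorem isHomog_gForm (hF : IsMinkowskiNorm F) : IsHomog 0 (gForm F) :=
  (isHomog_fderiv_energy hF).fderiv_succ
    fun _ hx => (contDiffAt_fderiv_energy hF hx).differentiableAt (by simp)

theorem gForm_self (hF : IsMinkowskiNorm F) {x : E n} (hx : x ≠ 0) :
    gForm F x x = F x • fderiv ℝ F x := by
  have := (isHomog_fderiv_energy hF).fderiv_self hx
    ((contDiffAt_fderiv_energy hF hx).differentiableAt (by simp))
  rw [← fderiv_energy hF hx]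
  rwa [Nat.cast_one, one_smul] at this

theorem gForm_symm (hF : IsMinkowskiNorm F) {x : E n} (hx : x ≠ 0) (ξ η : E n) :
    gForm F x ξ η = gForm F x η ξ := by
  simpa [G_eq_gForm] using G_symm hF hx ξ η

theorem gForm_pos (hF : IsMinkowskiNorm F) {x : E n} (hx : x ≠ 0) {ξ : E n} (hξ : ξ ≠ 0) :
    0 < gForm F x ξ ξ := by
  rw [← G_eq_gForm]
  exact hF.elliptic x hx ξ hξ

theorem gForm_nondegenerate (hF : IsMinkowskiNorm F) {x : E n} (hx : x ≠ 0) (ξ : E n)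
    (h : ∀ η, gForm F x ξ η = 0) : ξ = 0 := by
  by_contra hξ
  exact (gForm_pos hF hx hξ).ne' (h ξ)

/-- Euler's identity in degree 0. It removes the radial component of a gradient from every
contraction with Q. -/
theorem fderiv_gForm_self (hF : IsMinkowskiNorm F) {x : E n} (hx : x ≠ 0) :
    fderiv ℝ (gForm F) x x = 0 := by
  rw [(isHomog_gForm hF).fderiv_self hx (differentiableAt_gForm hF hx), Nat.cast_zero]
  ext ξ η
  exact zero_mul (gForm F x ξ η)

/-- Symmetry of the second derivative of d(F²/2). Together with `fderiv_gForm_swap_right`, which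
differentiates the symmetry of G, it makes Q totally symmetric. -/
theorem fderiv_gForm_swap_left (hF : IsMinkowskiNorm F) {x : E n} (hx : x ≠ 0) (ξ η ζ : E n) :
    fderiv ℝ (gForm F) x ξ η ζ = fderiv ℝ (gForm F) x η ξ ζ := by
  have h := (((contDiffAt_fderiv_energy hF hx).of_le
    (WithTop.coe_le_coe.2 (le_top : (2 : ℕ∞) ≤ ⊤))).isSymmSndFDerivAt (by simp)).eq ξ η
  exact congrArg (fun L : E n →L[ℝ] ℝ => L ζ) h

theorem fderiv_gForm_swap_right (hF : IsMinkowskiNorm F) {x : E n} (hx : x ≠ 0) (ξ η ζ : E n) :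
    fderiv ℝ (gForm F) x ξ η ζ = fderiv ℝ (gForm F) x ξ ζ η := by
  have hd := (differentiableAt_gForm hF hx).hasFDerivAt
  have h : ∀ a b : E n, fderiv ℝ (fun y => gForm F y a b) x ξ = fderiv ℝ (gForm F) x ξ a b := by
    intro a b
    rw [((hd.clm_apply (hasFDerivAt_const a x)).clm_apply (hasFDerivAt_const b x)).fderiv]
    simp
  have heq : (fun y => gForm F y η ζ) =ᶠ[𝓝 x] fun y => gForm F y ζ η := by
    filter_upwards [isOpen_compl_singleton.mem_nhds hx] with y hy
    exact gForm_symm hF hy η ζ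
  rw [← h, ← h, heq.fderiv_eq]

theorem isInvertible_gForm (hF : IsMinkowskiNorm F) {x : E n} (hx : x ≠ 0) :
    (gForm F x).IsInvertible := by
  have hinj : Function.Injective (gForm F x).toLinearMap := by
    rw [← LinearMap.ker_eq_bot, LinearMap.ker_eq_bot']
    intro ξ hξ
    exact gForm_nondegenerate hF hx ξ fun η => congrArg (fun L : E n →L[ℝ] ℝ => L η) hξ
  have hdim : Module.finrank ℝ (E n) = Module.finrank ℝ (E n →L[ℝ] ℝ) := by
    rw [← (LinearMap.toContinuousLinearMap (𝕜 := ℝ) (E := E n) (F' := ℝ)).finrank_eq]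
    exact (Subspace.dual_finrank_eq (K := ℝ) (V := E n)).symm
  let e := LinearEquiv.ofInjectiveOfFinrankEq (gForm F x).toLinearMap hinj hdim
  refine ⟨e.toContinuousLinearEquiv, ?_⟩
  ext ξ η
  rfl

end MinkowskiForm

/-! ### The G-gradient of a 1-homogeneous function and its derivative. -/

section LegendreGradient

variable {n : ℕ} {F : E n → ℝ} {s : E n → ℝ}

/-- The gradient of `s` with respect to the metric `G`. -/
noncomputable def gGrad (F s : E n → ℝ) (x : E n) : E n :=
  (gForm F x).inverse (fderiv ℝ s x)

theorem gForm_gGrad (hF : IsMinkowskiNorm F) (s : E n → ℝ) {x : E n} (hx : x ≠ 0) :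
    gForm F x (gGrad F s x) = fderiv ℝ s x :=
  (isInvertible_gForm hF hx).self_apply_inverse _

theorem contDiffAt_of_ne {m : WithTop ℕ∞} (hs : ContDiffOn ℝ m s {0}ᶜ) {x : E n} (hx : x ≠ 0) :
    ContDiffAt ℝ m s x :=
  (hs x hx).contDiffAt (isOpen_compl_singleton.mem_nhds hx)

theorem contDiffAt_fderiv_of_ne (hs : ContDiffOn ℝ 2 s {0}ᶜ) {x : E n} (hx : x ≠ 0) :
    ContDiffAt ℝ 1 (fderiv ℝ s) x :=
  (contDiffAt_of_ne hs hx).fderiv_right (by norm_num)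

theorem contDiffAt_gGrad (hF : IsMinkowskiNorm F) (hs : ContDiffOn ℝ 2 s {0}ᶜ) {x : E n}
    (hx : x ≠ 0) : ContDiffAt ℝ 1 (gGrad F s) x := by
  have h1 : ContDiffAt ℝ 1 (fun y => (gForm F y).inverse) x :=
    ContDiffAt.comp x (isInvertible_gForm hF hx).contDiffAt_map_inverse
      ((contDiffAt_gForm hF hx).of_le (by exact_mod_cast le_top))
  exact h1.clm_apply (contDiffAt_fderiv_of_ne hs hx)

theorem isHomog_gGrad (hF : IsMinkowskiNorm F) (hs : ContDiffOn ℝ 2 s {0}ᶜ) (hh : IsHomog 1 s) :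
    IsHomog 0 (gGrad F s) := by
  intro t ht x hx
  have h1 := isHomog_gForm hF t ht x hx
  have h2 := hh.fderiv_succ (k := 0)
    (fun y hy => (contDiffAt_of_ne hs hy).differentiableAt (by simp)) t ht x hx
  simp only [pow_zero, one_smul] at h1 h2 ⊢
  rw [gGrad, gGrad, h1, h2]

theorem differentiableAt_gGrad (hF : IsMinkowskiNorm F) (hs : ContDiffOn ℝ 2 s {0}ᶜ) {x : E n}
    (hx : x ≠ 0) : DifferentiableAt ℝ (gGrad F s) x :=
  (contDiffAt_gGrad hF hs hx).differentiableAt (by simp)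

theorem fderiv_gGrad_self (hF : IsMinkowskiNorm F) (hs : ContDiffOn ℝ 2 s {0}ᶜ)
    (hh : IsHomog 1 s) {x : E n} (hx : x ≠ 0) : fderiv ℝ (gGrad F s) x x = 0 := by
  simpa using (isHomog_gGrad hF hs hh).fderiv_self hx (differentiableAt_gGrad hF hs hx)

theorem fderiv_gGrad_smul (hF : IsMinkowskiNorm F) (hs : ContDiffOn ℝ 2 s {0}ᶜ)
    (hh : IsHomog 1 s) {x : E n} (hx : x ≠ 0) {t : ℝ} (ht : 0 < t) :
    fderiv ℝ (gGrad F s) (t • x) = t⁻¹ • fderiv ℝ (gGrad F s) x := by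
  have := (isHomog_gGrad hF hs hh).smul_fderiv hx (differentiableAt_gGrad hF hs hx) ht
  rw [pow_zero, one_smul] at this
  rw [← this, inv_smul_smul₀ ht.ne']

/-- The product rule applied to ds = G(Y, ·). -/
theorem fderiv_fderiv_eq (hF : IsMinkowskiNorm F) (hs : ContDiffOn ℝ 2 s {0}ᶜ) {x : E n}
    (hx : x ≠ 0) (ξ η : E n) :
    fderiv ℝ (fderiv ℝ s) x ξ η =
      fderiv ℝ (gForm F) x ξ (gGrad F s x) η + gForm F x (fderiv ℝ (gGrad F s) x ξ) η := by
  have heq : fderiv ℝ s =ᶠ[𝓝 x] fun y => gForm F y (gGrad F s y) := by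
    filter_upwards [isOpen_compl_singleton.mem_nhds hx] with y hy
    exact (gForm_gGrad hF s hy).symm
  rw [heq.fderiv_eq, fderiv_clm_apply (differentiableAt_gForm hF hx)
    (differentiableAt_gGrad hF hs hx)]
  simp [add_comm]

/-- The Hessian of `s` and the term Q(ξ, Y, η) are both symmetric in ξ and η, hence so is their
difference. -/
theorem gForm_fderiv_gGrad_symm (hF : IsMinkowskiNorm F) (hs : ContDiffOn ℝ 2 s {0}ᶜ) {x : E n}
    (hx : x ≠ 0) (ξ η : E n) :
    gForm F x (fderiv ℝ (gGrad F s) x ξ) η = gForm F x ξ (fderiv ℝ (gGrad F s) x η) := by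
  have h := ((contDiffAt_of_ne hs hx).isSymmSndFDerivAt (by simp)).eq ξ η
  rw [fderiv_fderiv_eq hF hs hx, fderiv_fderiv_eq hF hs hx] at h
  rw [fderiv_gForm_swap_right hF hx ξ, fderiv_gForm_swap_left hF hx ξ,
    fderiv_gForm_swap_right hF hx η] at h
  rw [gForm_symm hF hx ξ]
  linarith

theorem gForm_fderiv_gGrad_radial (hF : IsMinkowskiNorm F) (hs : ContDiffOn ℝ 2 s {0}ᶜ)
    (hh : IsHomog 1 s) {x : E n} (hx : x ≠ 0) (ξ : E n) :
    gForm F x (fderiv ℝ (gGrad F s) x ξ) x = 0 := by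
  rw [gForm_fderiv_gGrad_symm hF hs hx, fderiv_gGrad_self hF hs hh hx, _root_.map_zero]

end LegendreGradient

/-! ### Orthonormal bases adapted to the radial direction. -/

section Frame

variable {n : ℕ} {F : E n → ℝ} {z : E n}

/-- A tangent frame orthonormal for `G(z)` together with `z` itself is a basis, orthonormal
for `G(z)`. -/
theorem exists_basis_of_frame (hF : IsMinkowskiNorm F) (hz : F z = 1) (hz0 : z ≠ 0)
    {e : Fin n → E n} (he : ∀ i, fderiv ℝ F z (e i) = 0)
    (ho : ∀ i j, gForm F z (e i) (e j) = if i = j then 1 else 0) :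
    ∃ c : Module.Basis (Unit ⊕ Fin n) ℝ (E n), (∀ u, c (Sum.inl u) = z) ∧
      (∀ i, c (Sum.inr i) = e i) ∧ ∀ ξ k, c.repr ξ k = gForm F z ξ (c k) := by
  let f : Unit ⊕ Fin n → E n := Sum.elim (fun _ => z) e
  have hzz : gForm F z z z = 1 := by
    rw [gForm_self hF hz0, hz, one_smul, fderiv_self hF hz0, hz]
  have hze : ∀ i, gForm F z z (e i) = 0 := fun i => by
    rw [gForm_self hF hz0, hz, one_smul, he]
  have hf : ∀ k l, gForm F z (f k) (f l) = if k = l then 1 else 0 := by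
    rintro (k | k) (l | l)
    · simpa [f] using hzz
    · simpa [f] using hze l
    · simpa [f] using (gForm_symm hF hz0 _ _).trans (hze k)
    · simpa [f] using ho k l
  have hsum : ∀ (a : Unit ⊕ Fin n → ℝ) l, gForm F z (∑ k, a k • f k) (f l) = a l := by
    intro a l
    simp only [map_sum, map_smul, _root_.sum_apply, _root_.smul_apply, hf]
    simp
  have hli : LinearIndependent ℝ f := by
    rw [Fintype.linearIndependent_iff]
    intro a ha l
    rw [← hsum a l, ha]
    simp
  have hcard : Fintype.card (Unit ⊕ Fin n) = Module.finrank ℝ (E n) := by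
    simp [add_comm]
  let c := basisOfLinearIndependentOfCardEqFinrank hli hcard
  have hc : ∀ k, c k = f k := fun k => by simp [c]
  refine ⟨c, fun u => hc _, fun i => hc _, fun ξ k => ?_⟩
  conv_rhs => rw [← c.sum_repr ξ]
  simp_rw [hc]
  rw [hsum]

end Frame

/-! ### The matrix u_ij in local coordinates. -/

section Coordinates

variable {n : ℕ} {F s : E n → ℝ} {z : E n} {X : (Fin n → ℝ) → E n}

theorem IsCoordAt.mem_wulff (hX : IsCoordAt F z X) : F z = 1 := by
  have := hX.mem.self_of_nhds
  rwa [hX.center] at this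

theorem IsCoordAt.ne_zero (hF : IsMinkowskiNorm F) (hX : IsCoordAt F z X) : z ≠ 0 :=
  ne_zero_of_mem hF hX.mem_wulff

theorem IsCoordAt.eventually_ne (hF : IsMinkowskiNorm F) (hX : IsCoordAt F z X) :
    ∀ᶠ y in 𝓝 (0 : Fin n → ℝ), X y ≠ 0 := by
  filter_upwards [hX.mem] with y hy using ne_zero_of_mem hF hy

theorem IsCoordAt.eventually_differentiableAt (hX : IsCoordAt F z X) :
    ∀ᶠ y in 𝓝 (0 : Fin n → ℝ), DifferentiableAt ℝ X y := by
  have h1 : ContDiffAt ℝ 1 X 0 := hX.smooth.of_le (WithTop.coe_le_coe.2 (le_top : (1 : ℕ∞) ≤ ⊤))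
  filter_upwards [h1.eventually (by simp)] with y hy
  exact hy.differentiableAt (by simp)

theorem IsCoordAt.differentiableAt_pd (hX : IsCoordAt F z X) (j : Fin n) :
    DifferentiableAt ℝ (pd j X) 0 := by
  have h : ContDiffAt ℝ ∞ (fderiv ℝ X) 0 := hX.smooth.fderiv_right (by simp)
  exact (h.clm_apply contDiffAt_const).differentiableAt (by simp)

theorem pd_comp {W : Type*} [NormedAddCommGroup W] [NormedSpace ℝ W] {f : E n → W}
    {y : Fin n → ℝ} (hf : DifferentiableAt ℝ f (X y)) (hX : DifferentiableAt ℝ X y) (i : Fin n) :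
    pd i (f ∘ X) y = fderiv ℝ f (X y) (pd i X y) := by
  rw [pd, fderiv_comp y hf hX]
  rfl

theorem pd_congr {W : Type*} [NormedAddCommGroup W] [NormedSpace ℝ W] {f g : (Fin n → ℝ) → W}
    {y : Fin n → ℝ} (h : f =ᶠ[𝓝 y] g) (i : Fin n) : pd i f y = pd i g y := by
  rw [pd, pd, h.fderiv_eq]

theorem pd_eventuallyEq {W : Type*} [NormedAddCommGroup W] [NormedSpace ℝ W]
    {f g : (Fin n → ℝ) → W} {y : Fin n → ℝ} (h : f =ᶠ[𝓝 y] g) (i : Fin n) :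
    pd i f =ᶠ[𝓝 y] pd i g := by
  filter_upwards [h.fderiv (𝕜 := ℝ)] with x hx
  rw [pd, pd, hx]

theorem pd_clm_apply {V W : Type*} [NormedAddCommGroup V] [NormedSpace ℝ V]
    [NormedAddCommGroup W] [NormedSpace ℝ W] {A : (Fin n → ℝ) → V →L[ℝ] W} {f : (Fin n → ℝ) → V}
    {y : Fin n → ℝ} (hA : DifferentiableAt ℝ A y) (hf : DifferentiableAt ℝ f y) (i : Fin n) :
    pd i (fun x => A x (f x)) y = pd i A y (f y) + A y (pd i f y) := by
  rw [pd, fderiv_clm_apply hA hf]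
  simp [pd, add_comm]

theorem IsCoordAt.pd_pd_comp (hF : IsMinkowskiNorm F) (hX : IsCoordAt F z X)
    (hs : ContDiffOn ℝ 2 s {0}ᶜ) (i j : Fin n) :
    pd i (pd j (s ∘ X)) 0 = fderiv ℝ (fderiv ℝ s) z (pd i X 0) (pd j X 0) +
      fderiv ℝ s z (pd i (pd j X) 0) := by
  have hz0 := hX.ne_zero hF
  have hdX := hX.eventually_differentiableAt.self_of_nhds
  have h1 : pd j (s ∘ X) =ᶠ[𝓝 0] fun y => (fderiv ℝ s ∘ X) y (pd j X y) := by
    filter_upwards [hX.eventually_ne hF, hX.eventually_differentiableAt] with y hy hy'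
    exact pd_comp ((contDiffAt_of_ne hs hy).differentiableAt (by simp)) hy' j
  have hd : DifferentiableAt ℝ (fderiv ℝ s) (X 0) := by
    rw [hX.center]
    exact (contDiffAt_fderiv_of_ne hs hz0).differentiableAt (by simp)
  rw [pd_congr h1, pd_clm_apply (hd.comp _ hdX) (hX.differentiableAt_pd j), pd_comp hd hdX,
    Function.comp_apply, hX.center]

theorem IsCoordAt.pd_pd_comm (hX : IsCoordAt F z X) (i j : Fin n) :
    pd i (pd j X) 0 = pd j (pd i X) 0 := by
  have h : ∀ i j : Fin n, pd i (pd j X) 0 =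
      fderiv ℝ (fderiv ℝ X) 0 (Pi.single i 1) (Pi.single j 1) := by
    intro i j
    have hd : DifferentiableAt ℝ (fderiv ℝ X) 0 :=
      (hX.smooth.fderiv_right (m := ∞) (by simp)).differentiableAt (by simp)
    have := pd_clm_apply (A := fderiv ℝ X) (f := fun _ => Pi.single j 1) hd
      (differentiableAt_const _) i
    have hc : pd i (fun _ : Fin n → ℝ => (Pi.single j 1 : Fin n → ℝ)) 0 = 0 := by simp [pd]
    rw [hc, map_zero, add_zero] at this
    exact this
  rw [h, h]
  have h2 : ContDiffAt ℝ 2 X 0 := hX.smooth.of_le (WithTop.coe_le_coe.2 (le_top : (2 : ℕ∞) ≤ ⊤))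
  exact (h2.isSymmSndFDerivAt (by simp)).eq _ _

theorem IsCoordAt.fderiv_pd (hF : IsMinkowskiNorm F) (hX : IsCoordAt F z X) (j : Fin n) :
    fderiv ℝ F z (pd j X 0) = 0 := by
  have hd : DifferentiableAt ℝ F (X 0) := by
    rw [hX.center]; exact differentiableAt_F hF (hX.ne_zero hF)
  have h := pd_comp hd hX.eventually_differentiableAt.self_of_nhds j
  rw [hX.center] at h
  rw [← h]
  have hc : F ∘ X =ᶠ[𝓝 0] fun _ => (1 : ℝ) := hX.mem
  rw [pd_congr hc]
  simp [pd]

theorem IsCoordAt.gForm_pd (hX : IsCoordAt F z X) (i j : Fin n) :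
    gForm F z (pd i X 0) (pd j X 0) = if i = j then 1 else 0 := by
  have := congrFun (congrFun hX.orthonormal i) j
  rw [metric, Matrix.of_apply, G_eq_gForm, hX.center, Matrix.one_apply] at this
  exact this

/-- The radial component of the second derivatives of a parametrization. -/
theorem IsCoordAt.gForm_pd_pd (hF : IsMinkowskiNorm F) (hX : IsCoordAt F z X) (i j : Fin n) :
    gForm F z z (pd i (pd j X) 0) = -if i = j then 1 else 0 := by
  have hz0 := hX.ne_zero hF
  have he : ContDiffOn ℝ 2 (energy F) {0}ᶜ := fun x hx =>
    ((contDiffAt_energy hF hx).of_le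
      (WithTop.coe_le_coe.2 (le_top : (2 : ℕ∞) ≤ ⊤))).contDiffWithinAt
  have h := hX.pd_pd_comp hF he i j
  -- Two derivatives of the constant F²/2 along X give G(e_i, e_j) + d(F²/2)(∂_i∂_jX) = 0, and
  -- d(F²/2) at z is G(z, ·).
  have hc : energy F ∘ X =ᶠ[𝓝 0] fun _ => (1 / 2 : ℝ) := by
    filter_upwards [hX.mem] with y hy
    have hy' : F (X y) = 1 := hy
    simp [energy, hy']
  have h0 : pd i (pd j (energy F ∘ X)) 0 = 0 := by
    have h1 : pd j (fun _ : Fin n → ℝ => (1 / 2 : ℝ)) = fun _ => 0 := by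
      ext y; simp [pd]
    rw [pd_congr (pd_eventuallyEq hc j), h1]
    simp [pd]
  have hg : gForm F z z = fderiv ℝ (energy F) z := by
    rw [gForm_self hF hz0, fderiv_energy hF hz0]
  have ho := hX.gForm_pd i j
  rw [gForm] at ho
  rw [h0, ho] at h
  rw [hg]
  linarith

theorem IsCoordAt.pd_metric (hF : IsMinkowskiNorm F) (hX : IsCoordAt F z X) (i j l : Fin n) :
    pd i (fun y => metric F X y j l) 0 =
      fderiv ℝ (gForm F) z (pd i X 0) (pd j X 0) (pd l X 0) +
      gForm F z (pd i (pd j X) 0) (pd l X 0) + gForm F z (pd j X 0) (pd i (pd l X) 0) := by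
  have hdX := hX.eventually_differentiableAt.self_of_nhds
  have h1 : (fun y => metric F X y j l) = fun y => ((gForm F ∘ X) y (pd j X y)) (pd l X y) := by
    ext y
    rw [metric, Matrix.of_apply, G_eq_gForm]
    rfl
  have hd : DifferentiableAt ℝ (gForm F) (X 0) := by
    rw [hX.center]; exact differentiableAt_gForm hF (hX.ne_zero hF)
  have hdA : DifferentiableAt ℝ (gForm F ∘ X) 0 :=
    DifferentiableAt.comp (g := gForm F) (f := X) 0 hd hdX
  rw [h1, pd_clm_apply (A := fun y => (gForm F ∘ X) y (pd j X y))
    (hdA.clm_apply (hX.differentiableAt_pd j)) (hX.differentiableAt_pd l),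
    pd_clm_apply hdA (hX.differentiableAt_pd j), pd_comp hd hdX, Function.comp_apply, hX.center]
  simp

/-- By symmetry the three derivatives of G contribute Q + Q - Q, and the terms in second derivatives
of X cancel as for an induced Euclidean metric. -/
theorem IsCoordAt.christoffel_eq (hF : IsMinkowskiNorm F) (hX : IsCoordAt F z X) (k i j : Fin n) :
    christoffel (metric F X) k i j 0 =
      (1 / 2) * fderiv ℝ (gForm F) z (pd i X 0) (pd j X 0) (pd k X 0) +
      gForm F z (pd i (pd j X) 0) (pd k X 0) := by
  have hz0 := hX.ne_zero hF
  rw [christoffel, hX.orthonormal, inv_one]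
  simp only [Matrix.one_apply, ite_mul, one_mul, zero_mul, Finset.sum_ite_eq, Finset.mem_univ,
    if_true, hX.pd_metric hF]
  rw [hX.pd_pd_comm j i, hX.pd_pd_comm k i, hX.pd_pd_comm k j,
    fderiv_gForm_swap_left hF hz0 (pd j X 0) (pd i X 0),
    fderiv_gForm_swap_left hF hz0 (pd k X 0) (pd i X 0),
    fderiv_gForm_swap_right hF hz0 (pd i X 0) (pd k X 0),
    gForm_symm hF hz0 (pd i X 0), gForm_symm hF hz0 (pd j X 0) (pd i (pd k X) 0)]
  ring

/-- The matrix `uᵢⱼ` represents the derivative of the gradient of the `1`-homogeneous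
extension. -/
theorem IsCoordAt.uMat_eq (hF : IsMinkowskiNorm F) (hX : IsCoordAt F z X) {S : E n → ℝ}
    (hs : ContDiffOn ℝ 2 s {0}ᶜ) (hh : IsHomog 1 s) (hsS : ∀ x ∈ wulff F, s x = S x)
    (i j : Fin n) :
    uMat F X S i j = gForm F z (fderiv ℝ (gGrad F s) z (pd i X 0)) (pd j X 0) := by
  have hz0 := hX.ne_zero hF
  have hz := hX.mem_wulff
  have hdX := hX.eventually_differentiableAt.self_of_nhds
  have hds : DifferentiableAt ℝ s (X 0) := by
    rw [hX.center]; exact (contDiffAt_of_ne hs hz0).differentiableAt (by simp)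
  have hSs : S ∘ X =ᶠ[𝓝 0] s ∘ X := by
    filter_upwards [hX.mem] with y hy using (hsS _ hy).symm
  obtain ⟨c, hcz, hce, hcr⟩ := exists_basis_of_frame hF hz hz0 (hX.fderiv_pd hF) hX.gForm_pd
  set Y := gGrad F s z with hY
  have hYg := gForm_gGrad hF s hz0
  -- The coefficients are G(Y, z) = ds(z) = s(z), by Euler's identity, and G(Y, e_k) = ds(e_k).
  have hYsum : Y = s z • z + ∑ k, fderiv ℝ s z (pd k X 0) • pd k X 0 := by
    have h := c.sum_repr Y
    simp only [Fintype.sum_sum_type, hcr, hcz, hce, Finset.univ_unique, Finset.sum_singleton] at h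
    rw [hY, hYg, hh.fderiv_self hz0 ((contDiffAt_of_ne hs hz0).differentiableAt (by simp)),
      Nat.cast_one, one_smul] at h
    rw [hY]
    exact h.symm
  have h1 : ∀ k, pd k (S ∘ X) 0 = fderiv ℝ s z (pd k X 0) := fun k => by
    rw [pd_congr hSs, pd_comp hds hdX, hX.center]
  have h2 : pd i (pd j (S ∘ X)) 0 =
      fderiv ℝ (gForm F) z (pd i X 0) Y (pd j X 0) +
        gForm F z (fderiv ℝ (gGrad F s) z (pd i X 0)) (pd j X 0) +
        gForm F z Y (pd i (pd j X) 0) := by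
    rw [pd_congr (pd_eventuallyEq hSs j), hX.pd_pd_comp hF hs, fderiv_fderiv_eq hF hs hz0, hY, hYg]
  have h3 : fderiv ℝ (gForm F) z (pd i X 0) Y (pd j X 0) =
      ∑ k, fderiv ℝ (gForm F) z (pd i X 0) (pd j X 0) (pd k X 0) * fderiv ℝ s z (pd k X 0) := by
    rw [fderiv_gForm_swap_right hF hz0, hYsum, map_add, map_smul, map_sum,
      fderiv_gForm_swap_left hF hz0, fderiv_gForm_swap_right hF hz0,
      fderiv_gForm_swap_left hF hz0, fderiv_gForm_self hF hz0]
    simp [mul_comm]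
  -- The radial component of ∂_i∂_jX gives -s δ_ij, which the term S δ_ij of u_ij cancels; the
  -- tangential part is cancelled by the Christoffel symbols.
  have h4 : gForm F z Y (pd i (pd j X) 0) = -(s z * if i = j then 1 else 0) +
      ∑ k, gForm F z (pd i (pd j X) 0) (pd k X 0) * fderiv ℝ s z (pd k X 0) := by
    rw [gForm_symm hF hz0, hYsum, map_add, map_smul, map_sum, gForm_symm hF hz0 _ z,
      hX.gForm_pd_pd hF]
    simp [mul_comm]
  -- The Q-terms have total coefficient 1 - 1/2 - 1/2 = 0: from D²s, the Christoffel symbols and the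
  -- definition of u_ij.
  rw [uMat, Matrix.of_apply, covHess, h2, h3, h4, hX.center, ← hsS z hz]
  simp only [hX.christoffel_eq hF, h1, Q_eq, add_mul, Finset.sum_add_distrib, Finset.mul_sum,
    mul_assoc]
  ring_nf
  rw [← Finset.sum_mul]
  ring

theorem sum_dSigma_mul (U V : Matrix (Fin n) (Fin n) ℝ) :
    ∑ i, ∑ j, dSigma U i j * V i j = deriv (fun t : ℝ => (U + t • V).det) 0 := by
  have h : ∀ i j, dSigma U i j = (U.updateRow i (Pi.single j 1)).det := by
    intro i j
    have : (fun t : ℝ => (U + Matrix.single i j t).det) =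
        fun t : ℝ => (U + t • Matrix.single i j (1 : ℝ)).det := by
      ext t
      rw [Matrix.smul_single, smul_eq_mul, mul_one]
    rw [dSigma, this, deriv_det_add_smul, Finset.sum_eq_single i]
    · congr 2
      ext k
      simp [Matrix.single_apply, Pi.single_apply, eq_comm]
    · intro q _ hq
      refine Matrix.det_eq_zero_of_row_eq_zero q fun k => ?_
      simp [hq.symm]
    · simp
  rw [deriv_det_add_smul]
  refine Finset.sum_congr rfl fun i _ => ?_
  let D : (Fin n → ℝ) →ₗ[ℝ] ℝ :=
    { toFun := fun r => (U.updateRow i r).det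
      map_add' := fun a b => Matrix.det_updateRow_add _ _ _ _
      map_smul' := fun a b => Matrix.det_updateRow_smul _ _ _ _ }
  have hD := LinearMap.pi_apply_eq_sum_univ D (V i)
  change _ = D (V i)
  rw [hD]
  refine Finset.sum_congr rfl fun j _ => ?_
  rw [h, smul_eq_mul, mul_comm]
  congr 1
  change _ = (U.updateRow i _).det
  congr 2
  ext k
  simp [Pi.single_apply, eq_comm]

end Coordinates

/-! ### Compactness of the sublevel sets and of the Wulff shape. -/

section Bounds

variable {n : ℕ} {F : E n → ℝ}

theorem continuous_F (hF : IsMinkowskiNorm F) : Continuous F :=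
  continuousOn_univ.1 (hF.convex.continuousOn isOpen_univ)

theorem exists_mul_norm_le (hF : IsMinkowskiNorm F) : ∃ c : ℝ, 0 < c ∧ ∀ x, c * ‖x‖ ≤ F x := by
  obtain ⟨p, hp, hmin⟩ := (isCompact_sphere (0 : E n) 1).exists_isMinOn
    (NormedSpace.sphere_nonempty.2 zero_le_one) (continuous_F hF).continuousOn
  have hp0 : p ≠ 0 := by
    rintro rfl
    simp at hp
  refine ⟨F p, hF.pos p hp0, fun x => ?_⟩
  by_cases hx : x = 0
  · simp [hx, hF.map_zero]
  have hx' : 0 < ‖x‖ := norm_pos_iff.2 hx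
  have h1 : F p ≤ F (‖x‖⁻¹ • x) := hmin (by simp [norm_smul, hx'.ne'])
  rw [hF.homogeneous _ (inv_nonneg.2 hx'.le)] at h1
  rwa [← div_eq_inv_mul, le_div_iff₀ hx'] at h1

theorem isCompact_sublevel (hF : IsMinkowskiNorm F) (M : ℝ) : IsCompact {x | F x ≤ M} := by
  obtain ⟨c, hc, hb⟩ := exists_mul_norm_le hF
  refine Metric.isCompact_of_isClosed_isBounded (isClosed_le (continuous_F hF) continuous_const) ?_
  refine (Metric.isBounded_closedBall (x := (0 : E n)) (r := M / c)).subset fun x hx => ?_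
  rw [mem_closedBall_zero_iff, le_div_iff₀ hc, mul_comm]
  exact (hb x).trans hx

theorem isCompact_wulff (hF : IsMinkowskiNorm F) : IsCompact (wulff F) :=
  (isCompact_sublevel hF 1).of_isClosed_subset (isClosed_eq (continuous_F hF) continuous_const)
    fun _ hx => le_of_eq hx

theorem F_pos_iff (hF : IsMinkowskiNorm F) {x : E n} : 0 < F x ↔ x ≠ 0 := by
  refine ⟨?_, hF.pos x⟩
  rintro h rfl
  exact h.ne' hF.map_zero

end Bounds

/-! ### Radial projection and 1-homogeneous extension. -/

section Extension

variable {n : ℕ} {F S : E n → ℝ}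

/-- The radial projection onto the Wulff shape. -/
noncomputable def radialProj (F : E n → ℝ) (x : E n) : E n := (F x)⁻¹ • x

/-- The `1`-homogeneous extension of a function on the Wulff shape. -/
noncomputable def homExt (F S : E n → ℝ) (x : E n) : ℝ := F x * S (radialProj F x)

theorem radialProj_mem (hF : IsMinkowskiNorm F) {x : E n} (hx : x ≠ 0) :
    radialProj F x ∈ wulff F := by
  have h := hF.pos x hx
  change F ((F x)⁻¹ • x) = 1
  rw [hF.homogeneous _ (inv_nonneg.2 h.le), inv_mul_cancel₀ h.ne']

theorem radialProj_of_mem {x : E n} (hx : x ∈ wulff F) : radialProj F x = x := by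
  have hx' : F x = 1 := hx
  rw [radialProj, hx', inv_one, one_smul]

theorem smul_radialProj (hF : IsMinkowskiNorm F) {x : E n} (hx : x ≠ 0) :
    F x • radialProj F x = x := by
  rw [radialProj, smul_inv_smul₀ (hF.pos x hx).ne']

theorem radialProj_smul (hF : IsMinkowskiNorm F) {t : ℝ} (ht : 0 < t) (x : E n) :
    radialProj F (t • x) = radialProj F x := by
  rw [radialProj, radialProj, hF.homogeneous t ht.le, smul_smul]
  congr 1
  rw [mul_inv, mul_assoc, mul_comm, mul_assoc, mul_inv_cancel₀ ht.ne', mul_one]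

theorem contDiffOn_radialProj (hF : IsMinkowskiNorm F) : ContDiffOn ℝ ∞ (radialProj F) {0}ᶜ :=
  (hF.smooth.inv fun x hx => (hF.pos x hx).ne').smul contDiffOn_id

theorem contDiffOn_homExt (hF : IsMinkowskiNorm F) (hS : ContDiffOn ℝ 2 S (wulff F)) :
    ContDiffOn ℝ 2 (homExt F S) {0}ᶜ := by
  have h2 : (2 : WithTop ℕ∞) ≤ ∞ := WithTop.coe_le_coe.2 (le_top : (2 : ℕ∞) ≤ ⊤)
  exact (hF.smooth.of_le h2).mul
    (hS.comp ((contDiffOn_radialProj hF).of_le h2) fun x hx => radialProj_mem hF hx)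

theorem isHomog_homExt (hF : IsMinkowskiNorm F) (S : E n → ℝ) : IsHomog 1 (homExt F S) := by
  intro t ht x _
  rw [homExt, homExt, radialProj_smul hF ht, hF.homogeneous t ht.le, pow_one, smul_eq_mul,
    mul_assoc]

theorem homExt_of_mem {x : E n} (hx : x ∈ wulff F) : homExt F S x = S x := by
  have hx' : F x = 1 := hx
  rw [homExt, radialProj_of_mem hx, hx', one_mul]

end Extension

/-! ### The radial test field and the symmetric integral identity. -/

section RadialField

variable {n : ℕ} {F s v w : E n → ℝ} {χ : ℝ → ℝ} {a b : ℝ}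

/-- The radial vector field with profile `χ`. -/
noncomputable def radialField (F : E n → ℝ) (χ : ℝ → ℝ) (x : E n) : E n := χ (F x) • x

theorem hasFDerivAt_radialField (hF : IsMinkowskiNorm F) (hχ : ContDiff ℝ 1 χ) {x : E n}
    (hx : x ≠ 0) :
    HasFDerivAt (radialField F χ) (χ (F x) • ContinuousLinearMap.id ℝ (E n) +
      (deriv χ (F x) • fderiv ℝ F x).smulRight x) x :=
  (((hχ.differentiable (by simp) (F x)).hasDerivAt.comp_hasFDerivAt x
    (differentiableAt_F hF hx).hasFDerivAt).smul (hasFDerivAt_id x))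

theorem tsupport_radialField_subset (hF : IsMinkowskiNorm F)
    (hsupp : Function.support χ ⊆ Set.Icc a b) :
    tsupport (radialField F χ) ⊆ {x | F x ∈ Set.Icc a b} := by
  refine closure_minimal (fun x hx => hsupp ?_) (isClosed_Icc.preimage (continuous_F hF))
  intro h
  exact hx (by rw [radialField, h, zero_smul])

theorem tsupport_radialField_subset_compl (hF : IsMinkowskiNorm F) (ha : 0 < a)
    (hsupp : Function.support χ ⊆ Set.Icc a b) : tsupport (radialField F χ) ⊆ {0}ᶜ :=
  fun _ hx => (F_pos_iff hF).1 (ha.trans_le (tsupport_radialField_subset hF hsupp hx).1)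

theorem hasCompactSupport_radialField (hF : IsMinkowskiNorm F)
    (hsupp : Function.support χ ⊆ Set.Icc a b) : HasCompactSupport (radialField F χ) :=
  (isCompact_sublevel hF b).of_isClosed_subset (isClosed_tsupport _)
    fun _ hx => (tsupport_radialField_subset hF hsupp hx).2

theorem contDiff_radialField (hF : IsMinkowskiNorm F) (hχ : ContDiff ℝ 1 χ) (ha : 0 < a)
    (hsupp : Function.support χ ⊆ Set.Icc a b) : ContDiff ℝ 1 (radialField F χ) := by
  rw [contDiff_iff_contDiffAt]
  intro x
  by_cases hx : x = 0
  · have : radialField F χ =ᶠ[𝓝 x] fun _ => 0 :=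
      notMem_tsupport_iff_eventuallyEq.1 fun h =>
        tsupport_radialField_subset_compl hF ha hsupp h hx
    exact contDiffAt_const.congr_of_eventuallyEq this
  · exact (hχ.contDiffAt.comp x ((contDiffAt_F hF hx).of_le
      (WithTop.coe_le_coe.2 (le_top : (1 : ℕ∞) ≤ ⊤)))).smul contDiffAt_id

/-- Since G(x)(x, ·) = F dF, the rank one part of the derivative contributes the symmetric form χ' F
dF ⊗ dF. -/
theorem gForm_fderiv_radialField_symm (hF : IsMinkowskiNorm F) (hχ : ContDiff ℝ 1 χ) {x : E n}
    (hx : x ≠ 0) (ξ η : E n) :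
    gForm F x (fderiv ℝ (radialField F χ) x ξ) η =
      gForm F x ξ (fderiv ℝ (radialField F χ) x η) := by
  rw [(hasFDerivAt_radialField hF hχ hx).fderiv]
  simp only [_root_.add_apply, _root_.smul_apply, ContinuousLinearMap.smulRight_apply,
    ContinuousLinearMap.id_apply, map_add, map_smul, gForm_self hF hx, gForm_symm hF hx ξ x]
  simp only [smul_eq_mul]
  ring

/-- The weighted integral of the polarized Jacobian determinant is symmetric. -/
theorem integral_mul_mixedDet_gGrad_symm (hF : IsMinkowskiNorm F) (hχ : ContDiff ℝ 1 χ)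
    (ha : 0 < a) (hsupp : Function.support χ ⊆ Set.Icc a b) (hs : ContDiffOn ℝ 2 s {0}ᶜ)
    (hv : ContDiffOn ℝ 2 v {0}ᶜ) (hw : ContDiffOn ℝ 2 w {0}ᶜ) :
    ∫ x, w x * mixedDet (fderiv ℝ (gGrad F s) x) (fderiv ℝ (radialField F χ) x)
        (fderiv ℝ (gGrad F v) x) =
      ∫ x, v x * mixedDet (fderiv ℝ (gGrad F s) x) (fderiv ℝ (radialField F χ) x)
        (fderiv ℝ (gGrad F w) x) := by
  have hC : ∀ {f : E n → ℝ}, ContDiffOn ℝ 2 f {0}ᶜ → ContDiffOn ℝ 1 (gGrad F f) {0}ᶜ :=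
    fun hf x hx => (contDiffAt_gGrad hF hf hx).contDiffWithinAt
  have h1 : ∀ {f : E n → ℝ}, ContDiffOn ℝ 2 f {0}ᶜ → ContDiffOn ℝ 1 f {0}ᶜ :=
    fun hf => hf.of_le (by norm_num)
  have hζ := contDiff_radialField hF hχ ha hsupp
  have hζc := hasCompactSupport_radialField hF hsupp
  have hζΩ := tsupport_radialField_subset_compl hF ha hsupp
  rw [integral_mul_mixedDet_fderiv volume isOpen_compl_singleton (hC hs) hζ (hC hv) (h1 hw) hζc hζΩ,
    integral_mul_mixedDet_fderiv volume isOpen_compl_singleton (hC hs) hζ (hC hw) (h1 hv) hζc hζΩ]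
  congr 2
  ext x
  by_cases hx : x ∈ tsupport (radialField F χ)
  · have hx0 : x ≠ 0 := hζΩ hx
    refine mixedDet_eq_of_adjoint (gForm_nondegenerate hF hx0)
      (gForm_fderiv_gGrad_symm hF hs hx0) (gForm_fderiv_radialField_symm hF hχ hx0) fun ξ η => ?_
    -- Both sides of the adjointness relation equal dw(ξ) dv(η).
    simp only [ContinuousLinearMap.smulRight_apply, map_smul, _root_.smul_apply]
    rw [gForm_symm hF hx0 ξ, gForm_gGrad hF v hx0, gForm_gGrad hF w hx0]
    simp only [smul_eq_mul]
    ring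
  · simp_rw [fderiv_eq_zero_of_notMem_tsupport hx, mixedDet_zero_mid]

end RadialField

/-! ### Recovering L_S(v) from the polarized determinant. -/

section Pointwise

variable {n : ℕ} {F S v : E n → ℝ} {χ : ℝ → ℝ} {z : E n} {X : (Fin n → ℝ) → E n}

theorem deriv_det_smul_add_smul (U W : Matrix (Fin n) (Fin n) ℝ) (r : ℝ) :
    deriv (fun b : ℝ => (r • U + b • r • W).det) 0 =
      r ^ n * deriv (fun b : ℝ => (U + b • W).det) 0 := by
  have : ∀ b : ℝ, (r • U + b • r • W).det = r ^ n * (U + b • W).det := fun b => by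
    rw [smul_comm b r W, ← smul_add, Matrix.det_smul, Fintype.card_fin]
  simp_rw [this]
  rw [deriv_const_mul _ (hasDerivAt_det_add_smul _ _ _).differentiableAt]

/-- The polarized Jacobian determinant on rays through `z`. -/
theorem mixedDet_gGrad_homExt (hF : IsMinkowskiNorm F) (hX : IsCoordAt F z X)
    (hS : ContDiffOn ℝ 2 S (wulff F)) (hv : ContDiffOn ℝ 2 v (wulff F)) (hχ : ContDiff ℝ 1 χ)
    {r : ℝ} (hr : 0 < r) :
    mixedDet (fderiv ℝ (gGrad F (homExt F S)) (r • z)) (fderiv ℝ (radialField F χ) (r • z))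
        (fderiv ℝ (gGrad F (homExt F v)) (r • z)) =
      (χ r + r * deriv χ r) * (r⁻¹ ^ n * linOp F X S v) := by
  have hz0 := hX.ne_zero hF
  have hz := hX.mem_wulff
  obtain ⟨c, hcz, hce, hcr⟩ := exists_basis_of_frame hF hz hz0 (hX.fderiv_pd hF) hX.gForm_pd
  -- Homogeneity gives the factor r⁻¹ and the zero radial column; self-adjointness then gives the
  -- zero radial row.
  have hblock : ∀ {f : E n → ℝ}, ContDiffOn ℝ 2 f (wulff F) →
      LinearMap.toMatrix c c (fderiv ℝ (gGrad F (homExt F f)) (r • z)).toLinearMap =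
        Matrix.fromBlocks 0 0 0 (r⁻¹ • uMat F X f) := by
    intro f hf
    have he := contDiffOn_homExt hF hf
    have hh := isHomog_homExt hF f
    rw [fderiv_gGrad_smul hF he hh hz0 hr]
    ext (i | i) (j | j)
    · simp [LinearMap.toMatrix_apply, hcz, fderiv_gGrad_self hF he hh hz0]
    · simp [LinearMap.toMatrix_apply, hcr, hcz, gForm_fderiv_gGrad_radial hF he hh hz0]
    · simp [LinearMap.toMatrix_apply, hcz, fderiv_gGrad_self hF he hh hz0]
    · simp only [LinearMap.toMatrix_apply, hcr, hce, Matrix.fromBlocks_apply₂₂, Matrix.smul_apply]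
      rw [hX.uMat_eq hF he hh (fun x hx => homExt_of_mem hx),
        gForm_symm hF hz0 (fderiv ℝ (gGrad F (homExt F f)) z (pd i X 0)),
        ← gForm_fderiv_gGrad_symm hF he hz0]
      simp
  have hrz0 : r • z ≠ 0 := smul_ne_zero hr.ne' hz0
  have hFr : F (r • z) = r := by rw [hF.homogeneous r hr.le, hz, mul_one]
  have hDF : fderiv ℝ F (r • z) = fderiv ℝ F z := by
    simpa using (hF.isHomog.fderiv_succ (k := 0) fun _ => differentiableAt_F hF) r hr z hz0
  -- The radial eigenvalue is (r χ)' = χ + r χ', the tangential one is χ.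
  have hZ : LinearMap.toMatrix c c (fderiv ℝ (radialField F χ) (r • z)).toLinearMap =
      Matrix.fromBlocks ((χ r + r * deriv χ r) • 1) 0 0 (χ r • 1) := by
    have hz1 : ∀ ξ, fderiv ℝ (radialField F χ) (r • z) ξ =
        χ r • ξ + (deriv χ r * fderiv ℝ F z ξ * r) • z := fun ξ => by
      rw [(hasFDerivAt_radialField hF hχ hrz0).fderiv, hFr, hDF]
      simp [smul_smul]
    have hrepr : ∀ ξ k, c.repr (fderiv ℝ (radialField F χ) (r • z) ξ) k =
        χ r * c.repr ξ k + (deriv χ r * fderiv ℝ F z ξ * r) * c.repr z k := fun ξ k => by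
      rw [hz1]
      simp
    have hrz : ∀ k, c.repr z k = if k = Sum.inl () then 1 else 0 := fun k => by
      conv_lhs => rw [← hcz ()]
      simp [Finsupp.single_apply, eq_comm]
    have hzz : fderiv ℝ F z z = 1 := by rw [fderiv_self hF hz0, hz]
    ext (i | i) (j | j)
    · simp [LinearMap.toMatrix_apply, hrepr, hcz, hzz, hrz, mul_comm]
    · simp only [LinearMap.toMatrix_apply, ContinuousLinearMap.coe_coe, hrepr, hce, hX.fderiv_pd hF]
      rw [← hce]
      simp
    · simp [LinearMap.toMatrix_apply, hrepr, hcz, hrz]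
    · simp only [LinearMap.toMatrix_apply, ContinuousLinearMap.coe_coe, hrepr, hce, hX.fderiv_pd hF]
      rw [← hce]
      simp [Finsupp.single_apply, Matrix.one_apply, eq_comm]
  rw [mixedDet_of_block c (hblock hS) (hblock hv) hZ, deriv_det_smul_add_smul, ← sum_dSigma_mul,
    linOp]

end Pointwise

open scoped ENNReal NNReal Pointwise

/-! ### Polar coordinates and the cone measure. -/

section Polar

variable {n : ℕ} {F : E n → ℝ}

/-- The cone measure of the Wulff shape, normalized to be a surface measure. -/
noncomputable def coneMeasure {n : ℕ} (F : E n → ℝ) : Measure (E n) :=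
  ((n + 1 : ℕ) : ℝ≥0∞) • (volume.restrict {x | F x ≤ 1}).map (radialProj F)

/-- The radial part `rⁿ dr` of Lebesgue measure. -/
noncomputable def radialMeasure (n : ℕ) : Measure ℝ :=
  (volume.restrict (Set.Ioi 0)).withDensity fun r => ENNReal.ofReal (r ^ n)

instance (n : ℕ) : SigmaFinite (radialMeasure n) := by
  unfold radialMeasure
  exact SigmaFinite.withDensity_ofReal _

theorem measurable_radialProj (hF : IsMinkowskiNorm F) : Measurable (radialProj F) :=
  (continuous_F hF).measurable.inv.smul measurable_id

theorem isFiniteMeasure_coneMeasure (hF : IsMinkowskiNorm F) : IsFiniteMeasure (coneMeasure F) := by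
  have h : volume {x | F x ≤ 1} < ⊤ := (isCompact_sublevel hF 1).measure_lt_top
  refine ⟨?_⟩
  rw [coneMeasure, Measure.smul_apply, Measure.map_apply (measurable_radialProj hF) .univ,
    Set.preimage_univ, Measure.restrict_apply_univ, smul_eq_mul]
  exact ENNReal.mul_lt_top (ENNReal.natCast_lt_top _) h

theorem measurableSet_wulff (hF : IsMinkowskiNorm F) : MeasurableSet (wulff F) :=
  (isCompact_wulff hF).measurableSet

theorem coneMeasure_apply (hF : IsMinkowskiNorm F) {A : Set (E n)} (hA : MeasurableSet A) :
    coneMeasure F A = ((n + 1 : ℕ) : ℝ≥0∞) * volume (radialProj F ⁻¹' A ∩ {x | F x ≤ 1}) := by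
  rw [coneMeasure, Measure.smul_apply, Measure.map_apply (measurable_radialProj hF) hA,
    Measure.restrict_apply (measurable_radialProj hF hA), smul_eq_mul]

theorem coneMeasure_compl_wulff (hF : IsMinkowskiNorm F) : coneMeasure F (wulff F)ᶜ = 0 := by
  rw [coneMeasure_apply hF (measurableSet_wulff hF).compl]
  have : radialProj F ⁻¹' (wulff F)ᶜ ∩ {x | F x ≤ 1} ⊆ {0} := by
    rintro x ⟨hx, -⟩
    by_contra h
    exact hx (radialProj_mem hF h)
  rw [measure_mono_null this (measure_singleton 0), mul_zero]

theorem volume_cone_sublevel (hF : IsMinkowskiNorm F) (A : Set (E n)) {t : ℝ} (ht : 0 < t) :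
    volume (radialProj F ⁻¹' A ∩ {x | F x ≤ t}) =
      ENNReal.ofReal (t ^ (n + 1)) * volume (radialProj F ⁻¹' A ∩ {x | F x ≤ 1}) := by
  have : radialProj F ⁻¹' A ∩ {x | F x ≤ t} = t • (radialProj F ⁻¹' A ∩ {x | F x ≤ 1}) := by
    ext x
    rw [Set.mem_smul_set_iff_inv_smul_mem₀ ht.ne']
    simp only [Set.mem_inter_iff, Set.mem_preimage, Set.mem_ofPred_eq,
      radialProj_smul hF (inv_pos.2 ht), hF.homogeneous _ (inv_pos.2 ht).le]
    rw [inv_mul_le_iff₀ ht, mul_one]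
  rw [this, Measure.addHaar_smul]
  simp [abs_of_pos ht]

/-- The factor n + 1, also built into `coneMeasure`, cancels the denominator of ∫ rⁿ dr. -/
theorem radialMeasure_Iic {t : ℝ} (ht : 0 < t) :
    ((n + 1 : ℕ) : ℝ≥0∞) * radialMeasure n (Set.Iic t) = ENNReal.ofReal (t ^ (n + 1)) := by
  have h1 : radialMeasure n (Set.Iic t) = ∫⁻ r in Set.Ioc 0 t, ENNReal.ofReal (r ^ n) := by
    rw [radialMeasure, withDensity_apply _ measurableSet_Iic,
      Measure.restrict_restrict measurableSet_Iic, Set.inter_comm, Set.Ioi_inter_Iic]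
  have h2 : ∫⁻ r in Set.Ioc 0 t, ENNReal.ofReal (r ^ n) =
      ENNReal.ofReal (t ^ (n + 1) / (n + 1)) := by
    rw [← ofReal_integral_eq_lintegral_ofReal]
    · rw [← intervalIntegral.integral_of_le ht.le, integral_pow]
      simp
    · exact (continuous_pow n).integrableOn_Ioc
    · filter_upwards [ae_restrict_mem measurableSet_Ioc] with r hr
      exact pow_nonneg hr.1.le n
  rw [h1, h2, ← ENNReal.ofReal_natCast, ← ENNReal.ofReal_mul (by positivity)]
  congr 1
  push_cast
  field_simp

theorem radialMeasure_Iic_of_nonpos {t : ℝ} (ht : t ≤ 0) : radialMeasure n (Set.Iic t) = 0 := by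
  rw [radialMeasure, withDensity_apply _ measurableSet_Iic,
    Measure.restrict_restrict measurableSet_Iic, Set.inter_comm, Set.Ioi_inter_Iic,
    Set.Ioc_eq_empty (not_lt.2 ht)]
  simp

/-- For fixed A both sides are measures in T, so half-lines suffice; there the cone over A scales by
dilation. -/
theorem volume_cone_eq (hF : IsMinkowskiNorm F) {A : Set (E n)} (hA : MeasurableSet A)
    {T : Set ℝ} (hT : MeasurableSet T) :
    volume (radialProj F ⁻¹' A ∩ F ⁻¹' T) = coneMeasure F A * radialMeasure n T := by
  have hFm := (continuous_F hF).measurable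
  have hPA := measurable_radialProj hF hA
  have hfin := isFiniteMeasure_coneMeasure hF
  have key : (volume.restrict (radialProj F ⁻¹' A)).map F = coneMeasure F A • radialMeasure n := by
    refine Measure.ext_of_generateFrom_of_iUnion (Set.range Set.Iic) (fun k : ℕ => Set.Iic (k : ℝ))
      (borel_eq_generateFrom_Iic ℝ ▸ BorelSpace.measurable_eq) isPiSystem_Iic ?_ (fun k => ⟨k, rfl⟩)
      (fun k => ?_) ?_
    · refine Set.eq_univ_of_forall fun r => ?_
      obtain ⟨k, hk⟩ := exists_nat_ge r
      exact Set.mem_iUnion.2 ⟨k, hk⟩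
    · rw [Measure.map_apply hFm measurableSet_Iic]
      exact ((Measure.restrict_apply_le _ _).trans_lt (isCompact_sublevel hF k).measure_lt_top).ne
    · rintro _ ⟨t, rfl⟩
      rw [Measure.map_apply hFm measurableSet_Iic, Measure.restrict_apply (hFm measurableSet_Iic),
        Measure.smul_apply, smul_eq_mul, Set.inter_comm]
      rcases lt_or_ge 0 t with ht | ht
      · have := volume_cone_sublevel hF A ht
        refine this.trans ?_
        rw [← radialMeasure_Iic ht, coneMeasure_apply hF hA]
        ring
      · rw [radialMeasure_Iic_of_nonpos ht, mul_zero]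
        refine measure_mono_null ?_ (measure_singleton (0 : E n))
        rintro x ⟨-, hx⟩
        by_contra h
        exact absurd (hF.pos x h) (not_lt.2 (le_trans hx ht))
  have := congrArg (fun μ => μ T) key
  simp only [Measure.smul_apply, smul_eq_mul] at this
  rw [← this, Measure.map_apply hFm hT, Measure.restrict_apply (hFm hT), Set.inter_comm]

/-- Lebesgue measure in the polar coordinates of `F`. -/
theorem map_polar_eq_prod (hF : IsMinkowskiNorm F) :
    (volume : Measure (E n)).map (fun x => (radialProj F x, F x)) =
      (coneMeasure F).prod (radialMeasure n) := by
  have hfin := isFiniteMeasure_coneMeasure hF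
  symm
  refine Measure.prod_eq fun A T hA hT => ?_
  rw [Measure.map_apply ((measurable_radialProj hF).prodMk (continuous_F hF).measurable)
    (hA.prod hT), ← volume_cone_eq hF hA hT]
  rfl

theorem integral_polar (hF : IsMinkowskiNorm F) {f : E n → ℝ} {θ : ℝ → ℝ}
    (hf : AEStronglyMeasurable f (coneMeasure F)) (hθ : Measurable θ) :
    ∫ x, f (radialProj F x) * θ (F x) = (∫ z, f z ∂coneMeasure F) * ∫ r, θ r ∂radialMeasure n := by
  have hfin := isFiniteMeasure_coneMeasure hF
  rw [← integral_prod_mul, ← map_polar_eq_prod hF, integral_map]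
  · exact ((measurable_radialProj hF).prodMk (continuous_F hF).measurable).aemeasurable
  · rw [map_polar_eq_prod hF]
    exact hf.comp_fst.mul hθ.aestronglyMeasurable.comp_snd

theorem integral_radialMeasure (θ : ℝ → ℝ) :
    ∫ r, θ r ∂radialMeasure n = ∫ r in Set.Ioi 0, r ^ n * θ r := by
  rw [radialMeasure, integral_withDensity_eq_integral_toReal_smul (by fun_prop) (by simp)]
  refine setIntegral_congr_fun measurableSet_Ioi fun r hr => ?_
  simp only [smul_eq_mul]
  rw [ENNReal.toReal_ofReal (pow_nonneg (le_of_lt hr) n)]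

end Polar

/-! ### Hausdorff measure under bi-Lipschitz maps. -/

section HausdorffComparison

variable {V W : Type*} [MetricSpace V] [MeasurableSpace V] [BorelSpace V]
  [MetricSpace W] [MeasurableSpace W] [BorelSpace W]

theorem euclideanHausdorffMeasure_image_le {f : V → W} {A : Set V} {K : ℝ≥0}
    (hf : LipschitzOnWith K f A) (d : ℕ) :
    (μHE[d] : Measure W) (f '' A) ≤ (K : ℝ≥0∞) ^ d * (μHE[d] : Measure V) A := by
  have h := hf.hausdorffMeasure_image_le (d := d) (Nat.cast_nonneg d)
  rw [ENNReal.rpow_natCast] at h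
  simp only [Measure.euclideanHausdorffMeasure_def, Measure.smul_apply, ENNReal.smul_def,
    smul_eq_mul]
  rw [mul_left_comm]
  gcongr

theorem le_euclideanHausdorffMeasure_image {f : V → W} {A : Set V} {K : ℝ≥0}
    (hf : ∀ x ∈ A, ∀ y ∈ A, dist x y ≤ K * dist (f x) (f y)) (d : ℕ) :
    (μHE[d] : Measure V) A ≤ (K : ℝ≥0∞) ^ d * (μHE[d] : Measure W) (f '' A) := by
  rcases A.eq_empty_or_nonempty with rfl | ⟨a, ha⟩
  · simp
  have hinj : Set.InjOn f A := fun x hx y hy hxy => by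
    have := hf x hx y hy
    rw [hxy, dist_self, mul_zero] at this
    exact dist_le_zero.1 this
  have : Nonempty V := ⟨a⟩
  have hg : LipschitzOnWith K (Function.invFunOn f A) (f '' A) := by
    refine LipschitzOnWith.of_dist_le_mul ?_
    rintro _ ⟨x, hx, rfl⟩ _ ⟨y, hy, rfl⟩
    rw [hinj.leftInvOn_invFunOn hx, hinj.leftInvOn_invFunOn hy]
    exact hf x hx y hy
  have h := euclideanHausdorffMeasure_image_le hg d
  rwa [hinj.leftInvOn_invFunOn.image_image] at h

end HausdorffComparison

/-! ### From local to global estimates, and nearly isometric maps. -/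

section LocalComparison

/-- A local estimate between two measures near a compact set is global. -/
theorem measure_le_mul_of_locally {V : Type*} [TopologicalSpace V] [MeasurableSpace V]
    [OpensMeasurableSpace V] {μ ν : Measure V} {K : Set V} (hK : IsCompact K) {c : ℝ≥0∞}
    (h : ∀ p ∈ K, ∃ U ∈ 𝓝 p, ∀ A : Set V, MeasurableSet A → A ⊆ U → A ⊆ K → μ A ≤ c * ν A)
    {A : Set V} (hA : MeasurableSet A) (hAK : A ⊆ K) : μ A ≤ c * ν A := by
  have key : ∃ s : Set V, MeasurableSet s ∧ K ⊆ s ∧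
      ∀ A : Set V, MeasurableSet A → A ⊆ s → A ⊆ K → μ A ≤ c * ν A := by
    -- Carrying a measurable s around T lets a set be cut into A ∩ s and A \ s when two pieces are
    -- joined.
    refine hK.induction_on (p := fun T => ∃ s : Set V, MeasurableSet s ∧ T ⊆ s ∧
      ∀ A : Set V, MeasurableSet A → A ⊆ s → A ⊆ K → μ A ≤ c * ν A) ?_ ?_ ?_ ?_
    · refine ⟨∅, .empty, le_rfl, fun A _ hA _ => ?_⟩
      rw [Set.subset_empty_iff.1 hA]
      simp
    · rintro T T' hTT' ⟨s, hs, hTs, hsA⟩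
      exact ⟨s, hs, hTT'.trans hTs, hsA⟩
    · rintro T T' ⟨s, hs, hTs, hsA⟩ ⟨s', hs', hTs', hsA'⟩
      refine ⟨s ∪ s', hs.union hs', Set.union_subset_union hTs hTs', fun A hA hAs hAK => ?_⟩
      rw [← measure_inter_add_sdiff A hs, ← measure_inter_add_sdiff (μ := ν) A hs, mul_add]
      refine add_le_add (hsA _ (hA.inter hs) Set.inter_subset_right
        (Set.inter_subset_left.trans hAK)) (hsA' _ (hA.diff hs) ?_ (Set.sdiff_subset.trans hAK))
      rintro x ⟨hx, hxs⟩
      exact (hAs hx).resolve_left hxs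
    · intro p hp
      obtain ⟨U, hU, hUA⟩ := h p hp
      obtain ⟨O, hOU, hO, hpO⟩ := mem_nhds_iff.1 hU
      exact ⟨O, mem_nhdsWithin_of_mem_nhds (hO.mem_nhds hpO), O, hO.measurableSet, le_rfl,
        fun A hA hAO hAK => hUA A hA (hAO.trans hOU) hAK⟩
  obtain ⟨s, _, hKs, hs⟩ := key
  exact hs A hA (hAK.trans hKs) hAK

theorem le_of_forall_one_lt_coe_mul_le {a b : ℝ≥0∞}
    (h : ∀ κ : ℝ≥0, 1 < κ → a ≤ κ * b) : a ≤ b := by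
  have ht : Filter.Tendsto (fun κ : ℝ≥0 => (κ : ℝ≥0∞) * b) (𝓝[>] 1) (𝓝 (1 * b)) := by
    refine ENNReal.Tendsto.mul_const ?_ (Or.inl one_ne_zero)
    exact (ENNReal.tendsto_coe.2 Filter.tendsto_id).mono_left nhdsWithin_le_nhds
  rw [one_mul] at ht
  refine ge_of_tendsto ht ?_
  filter_upwards [self_mem_nhdsWithin] with κ hκ using h κ hκ

/-- A map with strict derivative the identity is nearly isometric. -/
theorem exists_nhds_nearly_isometric {V : Type*} [NormedAddCommGroup V] [NormedSpace ℝ V]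
    {f : V → V} {p : V} (hf : HasStrictFDerivAt f (ContinuousLinearMap.id ℝ V) p) {κ : ℝ≥0}
    (hκ : 1 < κ) :
    ∃ U ∈ 𝓝 p, LipschitzOnWith κ f U ∧ ∀ x ∈ U, ∀ y ∈ U, dist x y ≤ κ * dist (f x) (f y) := by
  have hκ' : (1 : ℝ) < κ := by exact_mod_cast hκ
  -- With this c the lower constant 1 - c is exactly κ⁻¹, and the upper one satisfies 1 + c ≤ κ
  -- because κ + κ⁻¹ ≥ 2.
  set c : ℝ≥0 := 1 - κ⁻¹ with hc
  have hinv : (κ : ℝ)⁻¹ < 1 := inv_lt_one_of_one_lt₀ hκ'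
  have hcR : (c : ℝ) = 1 - (κ : ℝ)⁻¹ := by
    rw [hc, NNReal.coe_sub (by exact_mod_cast hinv.le)]
    simp
  have hc0 : 0 < c := by
    rw [← NNReal.coe_pos, hcR]
    linarith
  obtain ⟨U, hU, happ⟩ := hf.approximates_deriv_on_nhds (Or.inr hc0)
  refine ⟨U, hU, LipschitzOnWith.of_dist_le_mul fun x hx y hy => ?_, fun x hx y hy => ?_⟩
  · have h := happ x hx y hy
    rw [ContinuousLinearMap.id_apply, hcR] at h
    have h2 := norm_sub_norm_le (f x - f y) (x - y)
    rw [dist_eq_norm, dist_eq_norm]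
    have h3 : (1 + (1 - (κ : ℝ)⁻¹)) ≤ κ := by
      have : 2 ≤ (κ : ℝ) + (κ : ℝ)⁻¹ := by
        have hpos : 0 < (κ : ℝ) := by linarith
        rw [← sub_nonneg]
        have : (κ : ℝ) + (κ : ℝ)⁻¹ - 2 = ((κ : ℝ) - 1) ^ 2 * (κ : ℝ)⁻¹ := by
          field_simp
          ring
        rw [this]
        positivity
      linarith
    nlinarith [norm_nonneg (x - y)]
  · have h := happ x hx y hy
    rw [ContinuousLinearMap.id_apply, hcR] at h
    have h2 := norm_sub_norm_le (x - y) (f x - f y)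
    rw [norm_sub_rev (x - y)] at h2
    rw [dist_eq_norm, dist_eq_norm]
    have h3 : (κ : ℝ)⁻¹ * ‖x - y‖ ≤ ‖f x - f y‖ := by nlinarith
    rwa [inv_mul_le_iff₀ (by linarith)] at h3

end LocalComparison

/-! ### The density of the anisotropic measure. -/

section Density

variable {n : ℕ} {F : E n → ℝ}

/-- Convexity and homogeneity give F(x + ty) ≤ F(x) + t F(y); this bounds the difference quotients.
-/
theorem fderiv_le (hF : IsMinkowskiNorm F) {x : E n} (hx : x ≠ 0) (y : E n) :
    fderiv ℝ F x y ≤ F y := by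
  have hd : HasDerivAt (fun t : ℝ => F (x + t • y)) (fderiv ℝ F x y) 0 := by
    have h0 : HasFDerivAt F (fderiv ℝ F x) (x + (0 : ℝ) • y) := by
      simpa using (differentiableAt_F hF hx).hasFDerivAt
    simpa [Function.comp_def] using h0.comp_hasDerivAt (0 : ℝ)
      (((hasDerivAt_id (0 : ℝ)).smul_const y).const_add x)
  refine le_of_tendsto hd.tendsto_slope_zero_right ?_
  filter_upwards [self_mem_nhdsWithin] with t ht
  have ht' : (0 : ℝ) < t := ht
  simp only [zero_add, zero_smul, add_zero, smul_eq_mul]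
  rw [inv_mul_le_iff₀ ht']
  have hconv : F ((1 / 2 : ℝ) • (2 : ℝ) • x + (1 / 2 : ℝ) • (2 * t) • y) ≤
      (1 / 2 : ℝ) • F ((2 : ℝ) • x) + (1 / 2 : ℝ) • F ((2 * t) • y) :=
    hF.convex.2 (Set.mem_univ _) (Set.mem_univ _) (by norm_num) (by norm_num) (by norm_num)
  rw [smul_smul, smul_smul, hF.homogeneous 2 (by norm_num),
    hF.homogeneous (2 * t) (by positivity)] at hconv
  norm_num at hconv
  rw [show 1 / 2 * (2 * t) = t by ring] at hconv
  linarith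

theorem gradient_ne_zero (hF : IsMinkowskiNorm F) {x : E n} (hx : x ≠ 0) : gradient F x ≠ 0 := by
  intro h
  have h1 : inner ℝ (gradient F x) x = fderiv ℝ F x x := inner_gradient_left
  rw [h, inner_zero_left, fderiv_self hF hx] at h1
  exact (hF.pos x hx).ne h1

/-- The supremum is bounded through `fderiv_le` and attained at x itself by Euler's identity. -/
theorem dualNorm_unitNormal (hF : IsMinkowskiNorm F) {x : E n} (hx : x ≠ 0) :
    dualNorm F (unitNormal F x) = ‖gradient F x‖⁻¹ := by
  have hN := norm_pos_iff.2 (gradient_ne_zero hF hx)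
  have hin : ∀ y, inner ℝ y (unitNormal F x) = ‖gradient F x‖⁻¹ * fderiv ℝ F x y := fun y => by
    rw [unitNormal, inner_smul_right, real_inner_comm, inner_gradient_left]
  have hle : ∀ y : {y : E n // y ≠ 0},
      inner ℝ y.1 (unitNormal F x) / F y.1 ≤ ‖gradient F x‖⁻¹ := fun y => by
    rw [div_le_iff₀ (hF.pos _ y.2), hin]
    exact mul_le_mul_of_nonneg_left (fderiv_le hF hx _) (by positivity)
  have : Nonempty {y : E n // y ≠ 0} := ⟨⟨x, hx⟩⟩
  refine le_antisymm (ciSup_le hle) ?_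
  refine le_ciSup_of_le ⟨_, Set.forall_mem_range.2 hle⟩ ⟨x, hx⟩ ?_
  change _ ≤ inner ℝ x (unitNormal F x) / F x
  rw [hin, fderiv_self hF hx, mul_div_assoc, div_self (hF.pos x hx).ne', mul_one]

theorem continuousAt_inv_norm_gradient (hF : IsMinkowskiNorm F) {x : E n} (hx : x ≠ 0) :
    ContinuousAt (fun y => ‖gradient F y‖⁻¹) x := by
  have h1 : ContinuousAt (fderiv ℝ F) x :=
    ((contDiffAt_F hF hx).fderiv_right (m := ∞) (by simp)).continuousAt
  have h2 : ContinuousAt (gradient F) x :=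
    (InnerProductSpace.toDual ℝ (E n)).symm.continuous.continuousAt.comp h1
  exact h2.norm.inv₀ (norm_ne_zero_iff.2 (gradient_ne_zero hF hx))

theorem anisoMeasure_apply (hF : IsMinkowskiNorm F) {A : Set (E n)} (hA : MeasurableSet A)
    (hAW : A ⊆ wulff F) :
    anisoMeasure F A = ∫⁻ x in A, ENNReal.ofReal ‖gradient F x‖⁻¹ ∂μHE[n] := by
  rw [anisoMeasure, withDensity_apply _ hA, Measure.restrict_restrict hA,
    Set.inter_eq_self_of_subset_left hAW]
  refine setLIntegral_congr_fun hA fun x hx => ?_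
  rw [dualNorm_unitNormal hF (ne_zero_of_mem hF (hAW hx))]

theorem anisoMeasure_compl_wulff (hF : IsMinkowskiNorm F) : anisoMeasure F (wulff F)ᶜ = 0 := by
  rw [anisoMeasure, withDensity_apply _ (measurableSet_wulff hF).compl,
    Measure.restrict_restrict (measurableSet_wulff hF).compl, Set.compl_inter_self]
  simp

end Density

/-! ### Volume of oblique prisms. -/

section Prism

variable {n : ℕ} {F : E n → ℝ} {p : E n}

/-- The volume of an oblique prism over a subset of a hyperplane. -/
theorem volume_prism (hF : IsMinkowskiNorm F) (hp : F p = 1) (hp0 : p ≠ 0) {B T : Set (E n)}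
    {I : Set ℝ} (hI : MeasurableSet I) (hT : MeasurableSet T)
    (hB : ∀ b ∈ B, fderiv ℝ F p b = 1)
    (hTB : ∀ y, y ∈ T ↔ ∃ b ∈ B, ∃ r ∈ I, b + (r - 1) • p = y) :
    volume T = ENNReal.ofReal ‖gradient F p‖⁻¹ * (volume I * μHE[n] B) := by
  set N := gradient F p with hN
  have hN0 : N ≠ 0 := gradient_ne_zero hF hp0
  have hNpos : 0 < ‖N‖ := norm_pos_iff.2 hN0
  have hNy : ∀ y, inner ℝ N y = fderiv ℝ F p y := fun y => inner_gradient_left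
  have hpp : fderiv ℝ F p p = 1 := by rw [fderiv_self hF hp0, hp]
  -- Scaled so that the hyperplane through x • v normal to v is {dF_p = x}. It meets T in a
  -- translate of B along p when x lies in I and in nothing otherwise; ‖v‖ = ‖N‖⁻¹ is the slicing
  -- factor.
  set v : E n := (‖N‖ ^ 2)⁻¹ • N with hv
  have hv0 : v ≠ 0 := smul_ne_zero (by positivity) hN0
  have hvn : ‖v‖ = ‖N‖⁻¹ := by
    rw [hv, norm_smul, Real.norm_of_nonneg (by positivity)]
    field_simp
  have hvv : ∀ x : ℝ, fderiv ℝ F p (x • v) = x := fun x => by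
    rw [← hNy, hv, smul_smul, inner_smul_right, real_inner_self_eq_norm_sq]
    field_simp
  have hrank : Module.finrank ℝ (E n) - 1 = n := by simp
  have h := EuclideanGeometry.euclideanHausdorffMeasure_eq_lintegral (0 : E n) hv0 hT
  rw [InnerProductSpace.euclideanHausdorffMeasure_eq_volume, hrank] at h
  rw [h]
  have hslice : ∀ x : ℝ, (μHE[n] : Measure (E n))
      (T ∩ AffineSubspace.mk' (x • v +ᵥ (0 : E n)) (Submodule.span ℝ {v})ᗮ) =
      I.indicator (fun _ => μHE[n] B) x := by
    intro x
    have hmem : ∀ y, y ∈ (AffineSubspace.mk' (x • v +ᵥ (0 : E n)) (Submodule.span ℝ {v})ᗮ :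
        Set (E n)) ↔ fderiv ℝ F p y = x := by
      intro y
      rw [SetLike.mem_coe, AffineSubspace.mem_mk',
        Submodule.mem_orthogonal_singleton_iff_inner_right]
      rw [vadd_eq_add, add_zero, vsub_eq_sub, hv, inner_smul_left, hNy, map_sub, ← hv, hvv]
      simp only [map_inv₀, mul_eq_zero, sub_eq_zero]
      constructor
      · rintro (h0 | h0)
        · exact absurd h0 (by simp [hN0])
        · exact h0
      · exact Or.inr
    by_cases hx : x ∈ I
    · rw [Set.indicator_of_mem hx]
      have : T ∩ AffineSubspace.mk' (x • v +ᵥ (0 : E n)) (Submodule.span ℝ {v})ᗮ =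
          (fun b => b + (x - 1) • p) '' B := by
        ext y
        rw [Set.mem_inter_iff, hmem, hTB]
        constructor
        · rintro ⟨⟨b, hb, r, hr, rfl⟩, hy⟩
          rw [map_add, map_smul, hB b hb, hpp, smul_eq_mul, mul_one] at hy
          have : r = x := by linarith
          subst this
          exact ⟨b, hb, rfl⟩
        · rintro ⟨b, hb, rfl⟩
          refine ⟨⟨b, hb, x, hx, rfl⟩, ?_⟩
          simp only [map_add, map_smul, hB b hb, hpp, smul_eq_mul, mul_one]
          ring
      rw [this, (isometry_add_right ((x - 1) • p)).euclideanHausdorffMeasure_image]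
    · rw [Set.indicator_of_notMem hx]
      have : T ∩ AffineSubspace.mk' (x • v +ᵥ (0 : E n)) (Submodule.span ℝ {v})ᗮ = ∅ := by
        refine Set.eq_empty_of_forall_notMem fun y hy => ?_
        rw [Set.mem_inter_iff, hmem, hTB] at hy
        obtain ⟨⟨b, hb, r, hr, rfl⟩, hy⟩ := hy
        rw [map_add, map_smul, hB b hb, hpp, smul_eq_mul, mul_one] at hy
        have : r = x := by linarith
        exact hx (this ▸ hr)
      rw [this, measure_empty]
  simp_rw [hslice]
  rw [lintegral_indicator_const hI, ← hvn, ofReal_norm, mul_comm (volume I)]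

end Prism

/-! ### The cone measure is the anisotropic measure. -/

section Straighten

variable {n : ℕ} {F : E n → ℝ} {p : E n}

/-- A map flattening the Wulff shape near `p` to its tangent plane at `p`, and rays to segments
parallel to `p`. -/
noncomputable def straighten (F : E n → ℝ) (p x : E n) : E n :=
  radialProj F x - fderiv ℝ F p (radialProj F x) • p + F x • p

/-- The derivative of `radialProj` at p is id - dF ⊗ p, whose composition with dF_p is zero; the
summand F x • p restores dF ⊗ p. -/
theorem hasStrictFDerivAt_straighten (hF : IsMinkowskiNorm F) (hp : F p = 1) (hp0 : p ≠ 0) :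
    HasStrictFDerivAt (straighten F p) (ContinuousLinearMap.id ℝ (E n)) p := by
  have hpp : fderiv ℝ F p p = 1 := by rw [fderiv_self hF hp0, hp]
  have hdF := (differentiableAt_F hF hp0).hasFDerivAt
  have hP : ContDiffAt ℝ ∞ (radialProj F) p :=
    (contDiffOn_radialProj hF p hp0).contDiffAt (isOpen_compl_singleton.mem_nhds hp0)
  have hPd : HasFDerivAt (radialProj F)
      (ContinuousLinearMap.id ℝ (E n) - (fderiv ℝ F p).smulRight p) p := by
    have h1 := (hasDerivAt_inv (x := F p) (by rw [hp]; exact one_ne_zero)).comp_hasFDerivAt p hdF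
    have h2 := h1.smul (hasFDerivAt_id p)
    refine h2.congr_fderiv ?_
    ext1 ξ
    simp [hp, sub_eq_add_neg]
  have hc : ContDiffAt ℝ ∞ (straighten F p) p :=
    (hP.sub (((fderiv ℝ F p).contDiff.contDiffAt.comp p hP).smul contDiffAt_const)).add
      ((contDiffAt_F hF hp0).smul contDiffAt_const)
  refine hc.hasStrictFDerivAt' ?_ (by simp)
  have h := (hPd.sub (((fderiv ℝ F p).hasFDerivAt.comp p hPd).smul_const p)).add
    (hdF.smul_const p)
  refine h.congr_fderiv ?_
  ext1 ξ
  simp [hpp]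

theorem straighten_of_mem {z : E n} (hz : z ∈ wulff F) :
    straighten F p z = z - fderiv ℝ F p z • p + p := by
  have hz' : F z = 1 := hz
  rw [straighten, radialProj_of_mem hz, hz', one_smul]

theorem radialMeasure_Ioc_bounds {δ : ℝ} {κ : ℝ≥0} (hκ : 1 + δ ≤ κ) :
    ENNReal.ofReal δ ≤ radialMeasure n (Set.Ioc 1 (1 + δ)) ∧
      radialMeasure n (Set.Ioc 1 (1 + δ)) ≤ (κ : ℝ≥0∞) ^ n * ENNReal.ofReal δ := by
  have hvol : volume (Set.Ioc 1 (1 + δ)) = ENNReal.ofReal δ := by simp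
  have hsub : Set.Ioc 1 (1 + δ) ∩ Set.Ioi 0 = Set.Ioc 1 (1 + δ) :=
    Set.inter_eq_left.2 fun r hr => zero_lt_one.trans hr.1
  rw [radialMeasure, withDensity_apply _ measurableSet_Ioc,
    Measure.restrict_restrict measurableSet_Ioc, hsub, ← hvol, ← setLIntegral_const,
    ← setLIntegral_one]
  constructor
  · refine setLIntegral_mono' measurableSet_Ioc fun r hr => ?_
    rw [ENNReal.one_le_ofReal]
    exact one_le_pow₀ hr.1.le
  · refine setLIntegral_mono' measurableSet_Ioc fun r hr => ?_
    rw [ENNReal.ofReal_pow (zero_le_one.trans hr.1.le)]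
    gcongr
    rw [ENNReal.ofReal_le_coe]
    exact hr.2.trans hκ

theorem exists_anisoMeasure_compare (hF : IsMinkowskiNorm F) (hp : p ∈ wulff F) {κ : ℝ≥0}
    (hκ : 1 < κ) :
    ∃ U ∈ 𝓝 p, ∀ A : Set (E n), MeasurableSet A → A ⊆ U → A ⊆ wulff F →
      anisoMeasure F A ≤ κ ^ (3 * n + 2) * coneMeasure F A ∧
      coneMeasure F A ≤ κ ^ (3 * n + 2) * anisoMeasure F A := by
  have hp0 := ne_zero_of_mem hF hp
  have hp1 : F p = 1 := hp
  have hκR : (1 : ℝ) < κ := by exact_mod_cast hκ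
  have hκ1 : (1 : ℝ≥0∞) ≤ κ := by exact_mod_cast hκ.le
  set d := ‖gradient F p‖⁻¹ with hd
  have hdpos : 0 < d := inv_pos.2 (norm_pos_iff.2 (gradient_ne_zero hF hp0))
  obtain ⟨U, hU, hlip, hanti⟩ :=
    exists_nhds_nearly_isometric (hasStrictFDerivAt_straighten hF hp1 hp0) hκ
  have hcd := continuousAt_inv_norm_gradient hF hp0
  have hU1 : ∀ᶠ x in 𝓝 p, ‖gradient F x‖⁻¹ < κ * d := by
    refine hcd.eventually_lt_const ?_
    nlinarith
  have hU2 : ∀ᶠ x in 𝓝 p, (κ : ℝ)⁻¹ * d < ‖gradient F x‖⁻¹ := by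
    refine hcd.eventually_const_lt ?_
    have : (κ : ℝ)⁻¹ < 1 := inv_lt_one_of_one_lt₀ hκR
    nlinarith
  -- Continuity of scaling at (1, p) keeps a sufficiently thin shell over a small A inside U.
  obtain ⟨pa, hpa, pb, hpb, hab⟩ : ∃ pa : ℝ → Prop, (∀ᶠ r in 𝓝 (1 : ℝ), pa r) ∧
      ∃ pb : E n → Prop, (∀ᶠ x in 𝓝 p, pb x) ∧ ∀ {r}, pa r → ∀ {x}, pb x → r • x ∈ U := by
    have : Filter.Tendsto (fun q : ℝ × E n => q.1 • q.2) (𝓝 ((1 : ℝ), p)) (𝓝 ((1 : ℝ) • p)) :=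
      (continuous_fst.smul continuous_snd).tendsto _
    rw [one_smul, nhds_prod_eq] at this
    exact Filter.eventually_prod_iff.1 (this hU)
  obtain ⟨δ₀, hδ₀, hball⟩ := Metric.eventually_nhds_iff.1 hpa
  set δ : ℝ := min (δ₀ / 2) (κ - 1) with hδ
  have hδpos : 0 < δ := lt_min (half_pos hδ₀) (sub_pos.2 hκR)
  have hδκ : 1 + δ ≤ κ := by linarith [min_le_right (δ₀ / 2) ((κ : ℝ) - 1)]
  set I : Set ℝ := Set.Ioc 1 (1 + δ) with hI
  have hpaI : ∀ r ∈ I, pa r := fun r hr => hball (by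
    rw [Real.dist_eq, abs_of_pos (sub_pos.2 hr.1)]
    linarith [hr.2, min_le_left (δ₀ / 2) ((κ : ℝ) - 1)])
  refine ⟨U ∩ ({x | ‖gradient F x‖⁻¹ < κ * d} ∩ {x | (κ : ℝ)⁻¹ * d < ‖gradient F x‖⁻¹} ∩
    {x | pb x}), Filter.inter_mem hU (Filter.inter_mem (Filter.inter_mem hU1 hU2) hpb),
    fun A hA hAU hAW => ?_⟩
  -- Its volume is the cone measure of A times a radial factor close to δ, and its straightened
  -- image is an oblique prism of height parameter δ over the flattened A.
  set shell : Set (E n) := radialProj F ⁻¹' A ∩ F ⁻¹' I with hshell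
  have hshellm : MeasurableSet shell := (measurable_radialProj hF hA).inter
    ((continuous_F hF).measurable measurableSet_Ioc)
  have hshell0 : ∀ x ∈ shell, x ≠ 0 := fun x hx =>
    (F_pos_iff hF).1 (zero_lt_one.trans hx.2.1)
  have hshellU : shell ⊆ U := fun x hx => by
    rw [← smul_radialProj hF (hshell0 x hx)]
    exact hab (hpaI _ hx.2) (hAU hx.1).2.2
  have hAU' : A ⊆ U := fun x hx => (hAU hx).1
  have hinj : Set.InjOn (straighten F p) shell := fun x hx y hy hxy => by
    have := hanti x (hshellU hx) y (hshellU hy)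
    rw [hxy, dist_self, mul_zero] at this
    exact dist_le_zero.1 this
  have hTm : MeasurableSet (straighten F p '' shell) :=
    hshellm.image_of_continuousOn_injOn (hlip.mono hshellU).continuousOn hinj
  have hpp : fderiv ℝ F p p = 1 := by rw [fderiv_self hF hp0, hp1]
  have hprism := volume_prism hF hp1 hp0 (B := straighten F p '' A)
    (T := straighten F p '' shell) (I := I) measurableSet_Ioc hTm
    (by
      rintro _ ⟨z, hz, rfl⟩
      rw [straighten_of_mem (hAW hz)]
      simp [hpp])
    (by
      intro y
      constructor
      · rintro ⟨x, hx, rfl⟩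
        refine ⟨_, ⟨radialProj F x, hx.1, rfl⟩, F x, hx.2, ?_⟩
        rw [straighten_of_mem (hAW hx.1), straighten, sub_smul, one_smul]
        abel
      · rintro ⟨_, ⟨z, hz, rfl⟩, r, hr, rfl⟩
        have hr0 : 0 < r := zero_lt_one.trans hr.1
        have hz1 : F z = 1 := hAW hz
        have hPz : radialProj F (r • z) = z := by
          rw [radialProj_smul hF hr0, radialProj_of_mem (hAW hz)]
        have hFz : F (r • z) = r := by rw [hF.homogeneous r hr0.le, hz1, mul_one]
        refine ⟨r • z, ⟨?_, ?_⟩, ?_⟩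
        · rwa [Set.mem_preimage, hPz]
        · rwa [Set.mem_preimage, hFz]
        · rw [straighten_of_mem (hAW hz), straighten, hPz, hFz, sub_smul, one_smul]
          abel)
  have hIvol : volume I = ENNReal.ofReal δ := by simp [hI]
  rw [hIvol] at hprism
  have hvol : (μHE[n + 1] : Measure (E n)) = volume := by
    have := InnerProductSpace.euclideanHausdorffMeasure_eq_volume (V := E n)
    rwa [finrank_euclideanSpace_fin] at this
  have hcone := volume_cone_eq hF hA (measurableSet_Ioc (a := 1) (b := 1 + δ))
  obtain ⟨hρ1, hρ2⟩ := radialMeasure_Ioc_bounds (n := n) hδκ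
  have b1 := euclideanHausdorffMeasure_image_le (hlip.mono hAU') n
  have b2 := le_euclideanHausdorffMeasure_image
    (fun x hx y hy => hanti x (hAU' hx) y (hAU' hy)) n
  have b3 := euclideanHausdorffMeasure_image_le (hlip.mono hshellU) (n + 1)
  have b4 := le_euclideanHausdorffMeasure_image
    (fun x hx y hy => hanti x (hshellU hx) y (hshellU hy)) (n + 1)
  rw [hvol, hprism] at b3 b4
  rw [hcone] at b3 b4
  have a1 : anisoMeasure F A ≤ κ * ENNReal.ofReal d * μHE[n] A := by
    rw [anisoMeasure_apply hF hA hAW, ← setLIntegral_const]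
    refine setLIntegral_mono' hA fun x hx => ?_
    rw [← ENNReal.ofReal_coe_nnreal, ← ENNReal.ofReal_mul (NNReal.coe_nonneg κ)]
    exact ENNReal.ofReal_le_ofReal (hAU hx).2.1.1.le
  have a2 : ENNReal.ofReal d * μHE[n] A ≤ κ * anisoMeasure F A := by
    rw [anisoMeasure_apply hF hA hAW, ← setLIntegral_const,
      ← lintegral_const_mul' _ _ ENNReal.coe_ne_top]
    refine setLIntegral_mono' hA fun x hx => ?_
    rw [← ENNReal.ofReal_coe_nnreal, ← ENNReal.ofReal_mul (NNReal.coe_nonneg κ)]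
    refine ENNReal.ofReal_le_ofReal ?_
    rw [← inv_mul_le_iff₀ (by linarith)]
    exact (hAU hx).2.1.2.le
  have hδ0 : ENNReal.ofReal δ ≠ 0 := by simpa using hδpos
  set H := (μHE[n] : Measure (E n)) A
  set H' := (μHE[n] : Measure (E n)) (straighten F p '' A)
  set C := coneMeasure F A
  set R := radialMeasure n (Set.Ioc 1 (1 + δ))
  set D := ENNReal.ofReal d
  have c1 : D * H' ≤ κ ^ (2 * n + 1) * C := by
    refine (ENNReal.mul_le_mul_iff_right hδ0 ENNReal.ofReal_ne_top).1 ?_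
    calc ENNReal.ofReal δ * (D * H') = D * (ENNReal.ofReal δ * H') := by ring
      _ ≤ κ ^ (n + 1) * (C * R) := b3
      _ ≤ κ ^ (n + 1) * (C * (κ ^ n * ENNReal.ofReal δ)) := by gcongr
      _ = ENNReal.ofReal δ * (κ ^ (2 * n + 1) * C) := by ring
  have c2 : C ≤ κ ^ (n + 1) * (D * H') := by
    refine (ENNReal.mul_le_mul_iff_right hδ0 ENNReal.ofReal_ne_top).1 ?_
    calc ENNReal.ofReal δ * C ≤ R * C := by gcongr
      _ = C * R := mul_comm _ _
      _ ≤ κ ^ (n + 1) * (D * (ENNReal.ofReal δ * H')) := b4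
      _ = ENNReal.ofReal δ * (κ ^ (n + 1) * (D * H')) := by ring
  -- The density costs κ, the flattening of A costs κ^n, and the shell comparison costs κ^(2n+1) one
  -- way and κ^(n+1) the other; 3n + 2 covers both totals.
  constructor
  · calc anisoMeasure F A ≤ κ * D * H := a1
      _ ≤ κ * D * (κ ^ n * H') := by gcongr
      _ = κ ^ (n + 1) * (D * H') := by ring
      _ ≤ κ ^ (n + 1) * (κ ^ (2 * n + 1) * C) := by gcongr
      _ = κ ^ (3 * n + 2) * C := by ring
  · calc C ≤ κ ^ (n + 1) * (D * H') := c2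
      _ ≤ κ ^ (n + 1) * (D * (κ ^ n * H)) := by gcongr
      _ = κ ^ (2 * n + 1) * (D * H) := by ring
      _ ≤ κ ^ (2 * n + 1) * (κ * anisoMeasure F A) := by gcongr
      _ = κ ^ (2 * n + 2) * anisoMeasure F A := by ring
      _ ≤ κ ^ (3 * n + 2) * anisoMeasure F A := by
        have hpow : (κ : ℝ≥0∞) ^ (2 * n + 2) ≤ κ ^ (3 * n + 2) :=
          pow_le_pow_right₀ hκ1 (by omega)
        exact mul_le_mul_left hpow _

theorem anisoMeasure_eq_coneMeasure (hF : IsMinkowskiNorm F) : anisoMeasure F = coneMeasure F := by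
  have hcmp : ∀ κ : ℝ≥0, 1 < κ → ∀ A, MeasurableSet A → A ⊆ wulff F →
      anisoMeasure F A ≤ κ * coneMeasure F A ∧ coneMeasure F A ≤ κ * anisoMeasure F A := by
    intro κ hκ A hA hAW
    obtain ⟨l, hl, hlκ⟩ : ∃ l : ℝ≥0, 1 < l ∧ l ^ (3 * n + 2) ≤ κ := by
      have ht : Filter.Tendsto (fun l : ℝ≥0 => l ^ (3 * n + 2)) (𝓝[>] 1) (𝓝 (1 ^ (3 * n + 2))) :=
        ((continuous_pow (3 * n + 2)).tendsto 1).mono_left nhdsWithin_le_nhds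
      rw [one_pow] at ht
      have := (ht.eventually_lt_const hκ).and self_mem_nhdsWithin
      obtain ⟨l, h1, h2⟩ := this.exists
      exact ⟨l, h2, h1.le⟩
    have hlκ' : (l : ℝ≥0∞) ^ (3 * n + 2) ≤ κ := by exact_mod_cast hlκ
    have h1 := measure_le_mul_of_locally (μ := anisoMeasure F) (ν := coneMeasure F)
      (isCompact_wulff hF) (c := (l : ℝ≥0∞) ^ (3 * n + 2)) (fun p hp => by
        obtain ⟨U, hU, h⟩ := exists_anisoMeasure_compare hF hp hl
        exact ⟨U, hU, fun A hA hAU hAW => (h A hA hAU hAW).1⟩) hA hAW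
    have h2 := measure_le_mul_of_locally (μ := coneMeasure F) (ν := anisoMeasure F)
      (isCompact_wulff hF) (c := (l : ℝ≥0∞) ^ (3 * n + 2)) (fun p hp => by
        obtain ⟨U, hU, h⟩ := exists_anisoMeasure_compare hF hp hl
        exact ⟨U, hU, fun A hA hAU hAW => (h A hA hAU hAW).2⟩) hA hAW
    exact ⟨h1.trans (by gcongr), h2.trans (by gcongr)⟩
  ext A hA
  have hW := measurableSet_wulff hF
  have h1 : anisoMeasure F (A \ wulff F) = 0 :=
    measure_mono_null (fun x hx => hx.2) (anisoMeasure_compl_wulff hF)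
  have h2 : coneMeasure F (A \ wulff F) = 0 :=
    measure_mono_null (fun x hx => hx.2) (coneMeasure_compl_wulff hF)
  rw [← measure_inter_add_sdiff A hW, ← measure_inter_add_sdiff (μ := coneMeasure F) A hW,
    h1, h2, add_zero, add_zero]
  exact le_antisymm
    (le_of_forall_one_lt_coe_mul_le fun κ hκ =>
      (hcmp κ hκ _ (hA.inter hW) Set.inter_subset_right).1)
    (le_of_forall_one_lt_coe_mul_le fun κ hκ =>
      (hcmp κ hκ _ (hA.inter hW) Set.inter_subset_right).2)

end Straighten

/-! ### The radial profile. -/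

section Bump

variable {χ : ℝ → ℝ}

/-- The conditions at 2 make χ + r χ' equal to 1 there, so L_S(v) can be read off at the point 2z;
nonnegativity serves the radial integral. -/
theorem exists_radial_bump : ∃ χ : ℝ → ℝ, ContDiff ℝ 1 χ ∧ Function.support χ ⊆ Set.Icc 1 3 ∧
    χ 2 = 1 ∧ deriv χ 2 = 0 ∧ ∀ r, 0 ≤ χ r := by
  let b : ContDiffBump (2 : ℝ) := ⟨1 / 2, 1, by norm_num, by norm_num⟩
  refine ⟨b, b.contDiff, ?_, b.one_of_mem_closedBall (by simp [b]), ?_, fun r => b.nonneg⟩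
  · rw [b.support_eq, Real.ball_eq_Ioo]
    refine Set.Ioo_subset_Icc_self.trans (Set.Icc_subset_Icc ?_ ?_) <;> norm_num [b]
  · rw [b.eventuallyEq_one.deriv_eq]
    simp

/-- The integrand is (r² χ)' - r χ, so the integral is -∫ r χ < 0. The factor r, due to the degree
of w, is essential: without it the integrand would be (r χ)', with integral zero. -/
theorem integral_radial_weight_ne_zero (hχ : ContDiff ℝ 1 χ)
    (hsupp : Function.support χ ⊆ Set.Icc 1 3) (h2 : χ 2 = 1) (h0 : ∀ r, 0 ≤ χ r) :
    ∫ r in Set.Ioi 0, r * (χ r + r * deriv χ r) ≠ 0 := by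
  have hc : HasCompactSupport χ := HasCompactSupport.of_support_subset_isCompact isCompact_Icc hsupp
  have hχd := hχ.continuous_deriv le_rfl
  have hd0 : ∀ r, r ≤ 0 → deriv χ r = 0 := fun r hr => by
    refine Function.notMem_support.1 fun h => ?_
    have := closure_minimal hsupp isClosed_Icc (support_deriv_subset h)
    linarith [this.1]
  have hc0 : ∀ r, r ≤ 0 → χ r = 0 := fun r hr => by
    refine Function.notMem_support.1 fun h => ?_
    linarith [(hsupp h).1]
  rw [setIntegral_eq_integral_of_forall_compl_eq_zero fun r hr => by
    rw [hc0 r (not_lt.1 hr), hd0 r (not_lt.1 hr)]; ring]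
  have i1 : Integrable fun r => r * χ r :=
    (continuous_id.mul hχ.continuous).integrable_of_hasCompactSupport hc.mul_left
  have i2 : Integrable fun r => r ^ 2 * χ r :=
    ((continuous_pow 2).mul hχ.continuous).integrable_of_hasCompactSupport hc.mul_left
  have i3 : Integrable fun r => r ^ 2 * deriv χ r :=
    ((continuous_pow 2).mul hχd).integrable_of_hasCompactSupport hc.deriv.mul_left
  have hd : ∀ r, HasDerivAt (fun r => r ^ 2 * χ r) (2 * (r * χ r) + r ^ 2 * deriv χ r) r :=
    fun r => by
      refine ((hasDerivAt_pow 2 r).mul ((hχ.differentiable (by simp) r).hasDerivAt)).congr_deriv ?_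
      push_cast
      ring
  have hz := integral_eq_zero_of_hasDerivAt_of_integrable hd ((i1.const_mul 2).add i3) i2
  have hpos : 0 < ∫ r, r * χ r := by
    refine (continuous_id.mul hχ.continuous).integral_pos_of_hasCompactSupport_nonneg_nonzero
      hc.mul_left (fun r => ?_) (x := 2) (by simp [h2])
    rcases le_total r 0 with hr | hr
    · simp [hc0 r hr]
    · exact mul_nonneg hr (h0 r)
  have : ∫ r, r * (χ r + r * deriv χ r) = -∫ r, r * χ r := by
    have e : (fun r => r * (χ r + r * deriv χ r)) =
        fun r => (2 * (r * χ r) + r ^ 2 * deriv χ r) - r * χ r := by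
      ext r
      ring
    rw [e, integral_sub (f := fun r => 2 * (r * χ r) + r ^ 2 * deriv χ r)
      ((i1.const_mul 2).add i3) i1, hz, zero_sub]
  rw [this]
  exact (neg_neg_of_pos hpos).ne

end Bump

/-! ### Integrability and factorization of the integrals. -/

section Symmetry

variable {n : ℕ} {F S v w : E n → ℝ} {X : E n → (Fin n → ℝ) → E n} {χ : ℝ → ℝ}

/-- The parametrizations `X z` need not vary continuously with z. Continuity comes from the
polarized determinant at 2z, which does not involve them. -/
theorem continuousOn_linOp (hF : IsMinkowskiNorm F)
    (hX : ∀ z ∈ wulff F, IsCoordAt F z (X z)) (hS : ContDiffOn ℝ 2 S (wulff F))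
    (hv : ContDiffOn ℝ 2 v (wulff F)) :
    ContinuousOn (fun z => linOp F (X z) S v) (wulff F) := by
  obtain ⟨χ, hχ, hsupp, h2, hd2, -⟩ := exists_radial_bump
  have hmaps : Set.MapsTo (fun z : E n => (2 : ℝ) • z) (wulff F) {0}ᶜ := fun z hz =>
    smul_ne_zero two_ne_zero (ne_zero_of_mem hF hz)
  have hgrad : ∀ {f : E n → ℝ}, ContDiffOn ℝ 2 f (wulff F) →
      ContinuousOn (fun z => fderiv ℝ (gGrad F (homExt F f)) ((2 : ℝ) • z)) (wulff F) := fun hf =>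
    ContinuousOn.comp (t := {0}ᶜ) (fun x hx =>
      ((contDiffAt_gGrad hF (contDiffOn_homExt hF hf) hx).continuousAt_fderiv
        one_ne_zero).continuousWithinAt) (continuous_const_smul (2 : ℝ)).continuousOn hmaps
  have hrad : ContinuousOn (fun z => fderiv ℝ (radialField F χ) ((2 : ℝ) • z)) (wulff F) :=
    (((contDiff_radialField hF hχ one_pos hsupp).continuous_fderiv one_ne_zero).comp
      (continuous_const_smul (2 : ℝ))).continuousOn
  refine (continuousOn_const (c := (2 : ℝ) ^ n).mul
    (continuousOn_mixedDet (hgrad hS) hrad (hgrad hv))).congr fun z hz => ?_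
  rw [Pi.mul_apply, mixedDet_gGrad_homExt hF (hX z hz) hS hv hχ two_pos, h2, hd2, mul_zero,
    add_zero, one_mul, inv_pow, mul_inv_cancel_left₀ (pow_ne_zero n two_ne_zero)]

theorem integrable_mul_linOp (hF : IsMinkowskiNorm F)
    (hX : ∀ z ∈ wulff F, IsCoordAt F z (X z)) (hS : ContDiffOn ℝ 2 S (wulff F))
    (hv : ContDiffOn ℝ 2 v (wulff F)) (hw : ContDiffOn ℝ 2 w (wulff F)) :
    Integrable (fun z => w z * linOp F (X z) S v) (coneMeasure F) := by
  have := isFiniteMeasure_coneMeasure hF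
  have h := (hw.continuousOn.mul (continuousOn_linOp hF hX hS hv)).integrableOn_compact
    (μ := coneMeasure F) (isCompact_wulff hF)
  rwa [IntegrableOn, Measure.restrict_eq_self_of_ae_mem
    (measure_eq_zero_iff_ae_notMem.1 (coneMeasure_compl_wulff hF) |>.mono fun _ => not_not.1)] at h

theorem integral_mul_mixedDet_eq (hF : IsMinkowskiNorm F)
    (hX : ∀ z ∈ wulff F, IsCoordAt F z (X z)) (hS : ContDiffOn ℝ 2 S (wulff F))
    (hv : ContDiffOn ℝ 2 v (wulff F)) (hw : ContDiffOn ℝ 2 w (wulff F)) (hχ : ContDiff ℝ 1 χ) :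
    ∫ x, homExt F w x * mixedDet (fderiv ℝ (gGrad F (homExt F S)) x)
        (fderiv ℝ (radialField F χ) x) (fderiv ℝ (gGrad F (homExt F v)) x) =
      (∫ z, w z * linOp F (X z) S v ∂coneMeasure F) *
        ∫ r in Set.Ioi 0, r * (χ r + r * deriv χ r) := by
  have hχd := hχ.continuous_deriv le_rfl
  -- The polar density rⁿ cancels the r⁻ⁿ of the determinant; the remaining r is the homogeneity of
  -- the extension of w.
  have hrad : ∫ r in Set.Ioi 0, r * (χ r + r * deriv χ r) =
      ∫ r, r * (χ r + r * deriv χ r) * r⁻¹ ^ n ∂radialMeasure n := by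
    rw [integral_radialMeasure]
    refine setIntegral_congr_fun measurableSet_Ioi fun r hr => ?_
    have hr0 : r ≠ 0 := ne_of_gt hr
    rw [inv_pow]
    field_simp
  rw [hrad, ← integral_polar hF (integrable_mul_linOp hF hX hS hv hw).aestronglyMeasurable (by
    have := hχ.continuous.measurable
    have := hχd.measurable
    fun_prop)]
  have hne : ∀ᵐ x : E n, x ≠ 0 := by simp [ae_iff]
  refine integral_congr_ae (hne.mono fun x hx => ?_)
  have hmem := radialProj_mem hF hx
  have hFx := (F_pos_iff hF).2 hx
  dsimp only
  conv_lhs => rw [← smul_radialProj hF hx, mixedDet_gGrad_homExt hF (hX _ hmem) hS hv hχ hFx,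
    isHomog_homExt hF w _ hFx _ (ne_zero_of_mem hF hmem), homExt_of_mem hmem]
  simp only [smul_eq_mul]
  ring

end Symmetry

end Aniso

theorem lemma5p2 (n : ℕ) (F : Aniso.E n → ℝ) (hF : Aniso.IsMinkowskiNorm F)
    (X : Aniso.E n → (Fin n → ℝ) → Aniso.E n)
    (hX : ∀ z ∈ Aniso.wulff F, Aniso.IsCoordAt F z (X z))
    (S v w : Aniso.E n → ℝ)
    (hS : ContDiffOn ℝ 2 S (Aniso.wulff F))
    (hv : ContDiffOn ℝ 2 v (Aniso.wulff F))
    (hw : ContDiffOn ℝ 2 w (Aniso.wulff F)) :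
    MeasureTheory.Integrable (fun z => w z * Aniso.linOp F (X z) S v) (Aniso.anisoMeasure F) ∧
    MeasureTheory.Integrable (fun z => v z * Aniso.linOp F (X z) S w) (Aniso.anisoMeasure F) ∧
    ∫ z, w z * Aniso.linOp F (X z) S v ∂(Aniso.anisoMeasure F) =
      ∫ z, v z * Aniso.linOp F (X z) S w ∂(Aniso.anisoMeasure F) := by
  rw [Aniso.anisoMeasure_eq_coneMeasure hF]
  refine ⟨Aniso.integrable_mul_linOp hF hX hS hv hw, Aniso.integrable_mul_linOp hF hX hS hw hv, ?_⟩
  obtain ⟨χ, hχ, hsupp, h2, -, h0⟩ := Aniso.exists_radial_bump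
  have h := Aniso.integral_mul_mixedDet_gGrad_symm hF hχ one_pos hsupp
    (Aniso.contDiffOn_homExt hF hS) (Aniso.contDiffOn_homExt hF hv) (Aniso.contDiffOn_homExt hF hw)
  rw [Aniso.integral_mul_mixedDet_eq hF hX hS hv hw hχ,
    Aniso.integral_mul_mixedDet_eq hF hX hS hw hv hχ] at h
  exact mul_right_cancel₀ (Aniso.integral_radial_weight_ne_zero hχ hsupp h2 h0) h
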